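/- All rings are commutative. Let $A$ be a ring and $\mathfrak a\subseteq A$ an ideal. For a sequence $\boldsymbol a=(a_1,\dots,a_p)$ in $A$ ($p\ge 1$) let $\mathrm K(A;\boldsymbol a)=\mathrm K(A;a_1)\otimes_A\cdots\otimes_A\mathrm K(A;a_p)$ be the Koszul complex, where $\mathrm K(A;a)=(A\xrightarrow{a\cdot}A)$ is concentrated in cohomological degrees $-1,0$, and put $\boldsymbol a^j=(a_1^j,\dots,a_p^j)$ for $j\ge1$. For $j_1\ge j_0\ge 1$ there is a transition map $\mathrm K(A;\boldsymbol a^{j_1})\to\mathrm K(A;\boldsymbol a^{j_0})$, the tensor product of the maps $\mathrm K(A;a_i^{j_1})\to\mathrm K(A;a_i^{j_0})$ that are the identity in degree $0$ and multiplication by $a_i^{j_1-j_0}$ in degree $-1$. The sequence $\boldsymbol a$ is weakly proregular if for every $i\le -1$ the inverse system $\{\mathrm H^i(\mathrm K(A;\boldsymbol a^j))\}_{j\ge 1}$ is pro-zero, i.e. for every $j_0\ge1$ there is some $j_1\ge j_0$ such that the map $\mathrm H^i(\mathrm K(A;\boldsymbol a^{j_1}))\to\mathrm H^i(\mathrm K(A;\boldsymbol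 a^{j_0}))$ is zero. The ideal $\mathfrak a$ is weakly proregular if it is generated by some (finite) weakly proregular sequence. An $A$-module $N$ is $\mathfrak a$-torsion if every element of $N$ is annihilated by $\mathfrak a^i$ for some $i\ge1$. An $A$-module $P$ is $\mathfrak a$-adically complete if the canonical map $P\to\varprojlim_k P/\mathfrak a^{k+1}P$ is bijective, and it is $\mathfrak a$-adically flat if $\operatorname{Tor}_i^A(P,N)=0$ for every $\mathfrak a$-torsion $A$-module $N$ and every $i>0$. **Theorem.** Let $A$ be a ring, let $\mathfrak a$ be a weakly proregular ideal in $A$, and let $P$ be an $\mathfrak a$-adically complete $A$-module. For $k\ge0$ define the ring $A_k:=A/\mathfrak a^{k+1}$ and the $A_k$-module $P_k:=A_k\otimes_A P$. Then the following three conditions are equivalent: (i) The $A$-module $P$ is $\mathfrak a$-adically flat. (ii) The functor $P\otimes_A(-)$ is exact on $\mathfrak a$-torsion $A$-modules. (iii) For every $k\ge0$ the $A_k$-module $P_k$ is flat. -/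

import Mathlib

open CategoryTheory TensorProduct

universe u

noncomputable section

/-! ### Koszul complexes -/

/-- Contraction with a linear form lowers the exterior degree by one. -/
theorem contractLeft_mem_exteriorPower {A : Type u} [CommRing A] {M : Type u} [AddCommGroup M]
    [Module A M] (φ : Module.Dual A M) (n : ℕ) (x : ExteriorAlgebra A M)
    (hx : x ∈ ⋀[A]^(n + 1) M) :
    CliffordAlgebra.contractLeft φ x ∈ ⋀[A]^n M := by
  rw [← ExteriorAlgebra.ιMulti_span_fixedDegree] at hx
  induction hx using Submodule.span_induction with
  | zero => simp
  | add x y _ _ hx hy => rw [map_add]; exact add_mem hx hy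
  | smul r x _ hx => rw [map_smul]; exact Submodule.smul_mem _ r hx
  | mem x hx =>
    obtain ⟨v, rfl⟩ := hx
    induction n with
    | zero =>
      rw [ExteriorAlgebra.ιMulti_succ_apply, ExteriorAlgebra.ι, CliffordAlgebra.contractLeft_ι_mul,
        ExteriorAlgebra.ιMulti_zero_apply, CliffordAlgebra.contractLeft_one, mul_zero, sub_zero]
      rw [ExteriorAlgebra.exteriorPower, pow_zero]
      exact Submodule.smul_mem _ _ (Submodule.one_le.mp le_rfl)
    | succ n ih =>
      rw [ExteriorAlgebra.ιMulti_succ_apply, ExteriorAlgebra.ι, CliffordAlgebra.contractLeft_ι_mul]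
      refine sub_mem (Submodule.smul_mem _ _ ?_) ?_
      · exact ExteriorAlgebra.ιMulti_range A (n + 1) (Set.mem_range_self _)
      · have h := ih (Matrix.vecTail v)
        rw [ExteriorAlgebra.exteriorPower, pow_succ']
        exact Submodule.mul_mem_mul (LinearMap.mem_range_self _ _) h

/-- Contraction with linear forms is compatible with maps of exterior algebras. -/
theorem map_contractLeft {A : Type u} [CommRing A] {M N : Type u} [AddCommGroup M] [Module A M]
    [AddCommGroup N] [Module A N] {φ : Module.Dual A M} {ψ : Module.Dual A N} {f : M →ₗ[A] N}
    (h : ψ ∘ₗ f = φ) (x : ExteriorAlgebra A M) :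
    ExteriorAlgebra.map f (CliffordAlgebra.contractLeft φ x) =
      CliffordAlgebra.contractLeft ψ (ExteriorAlgebra.map f x) := by
  subst h
  induction x using CliffordAlgebra.left_induction with
  | algebraMap r =>
    rw [CliffordAlgebra.contractLeft_algebraMap, map_zero, AlgHom.commutes,
      CliffordAlgebra.contractLeft_algebraMap]
  | add x y hx hy => simp only [map_add, hx, hy]
  | ι_mul x m hx =>
    have hm : ExteriorAlgebra.map f (CliffordAlgebra.ι (0 : QuadraticForm A M) m) =
        CliffordAlgebra.ι (0 : QuadraticForm A N) (f m) := ExteriorAlgebra.map_apply_ι f m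
    rw [CliffordAlgebra.contractLeft_ι_mul, map_sub, map_smul, map_mul, map_mul, hx, hm,
      CliffordAlgebra.contractLeft_ι_mul, LinearMap.comp_apply]

/-- On exterior powers, the map of exterior algebras is the map of exterior powers. -/
theorem coe_exteriorPower_map {A : Type u} [CommRing A] {M N : Type u} [AddCommGroup M]
    [Module A M] [AddCommGroup N] [Module A N] (f : M →ₗ[A] N) (n : ℕ) (x : ⋀[A]^n M) :
    (exteriorPower.map n f x : ExteriorAlgebra A N) =
      ExteriorAlgebra.map f (x : ExteriorAlgebra A M) := by
  have hx : x ∈ Submodule.span A (Set.range (exteriorPower.ιMulti A n (M := M))) := by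
    rw [exteriorPower.ιMulti_span]; trivial
  induction hx using Submodule.span_induction with
  | zero => simp
  | add x y _ _ hx hy => simp [hx, hy]
  | smul r x _ hx => simp [hx]
  | mem x hx =>
    obtain ⟨v, rfl⟩ := hx
    rw [exteriorPower.map_apply_ιMulti, exteriorPower.ιMulti_apply_coe,
      exteriorPower.ιMulti_apply_coe, ExteriorAlgebra.map_apply_ιMulti]

/-- The differential `⋀ⁿ⁺¹ M → ⋀ⁿ M` of the Koszul complex of a linear form `φ : M → A`, i.e.
`m₀ ∧ ⋯ ∧ mₙ ↦ ∑ₖ (-1)ᵏ φ(mₖ) m₀ ∧ ⋯ ∧ m̂ₖ ∧ ⋯ ∧ mₙ`; it is the restriction of the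
antiderivation of the exterior algebra which extends `φ`. -/
def koszulDifferential {A : Type u} [CommRing A] {M : Type u} [AddCommGroup M] [Module A M]
    (φ : Module.Dual A M) (n : ℕ) : ⋀[A]^(n + 1) M →ₗ[A] ⋀[A]^n M :=
  (CliffordAlgebra.contractLeft (Q := (0 : QuadraticForm A M)) φ).restrict
    (contractLeft_mem_exteriorPower φ n)

/-- The Koszul complex `⋯ → ⋀² M → M → A` of a linear form `φ : M → A`, with `⋀ⁿ M` in homological
degree `n`, i.e. in cohomological degree `-n`. -/
def koszulComplexOfForm {A : Type u} [CommRing A] {M : Type u} [AddCommGroup M] [Module A M]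
    (φ : Module.Dual A M) : ChainComplex (ModuleCat.{u} A) ℕ :=
  ChainComplex.of (fun n => ModuleCat.of A (⋀[A]^n M))
    (fun n => ModuleCat.ofHom (koszulDifferential φ n))
    (fun _ => ModuleCat.hom_ext (LinearMap.ext fun x => Subtype.ext
      (CliffordAlgebra.contractLeft_contractLeft (Q := (0 : QuadraticForm A M)) (d := φ)
        (x : ExteriorAlgebra A M))))

/-- The map of Koszul complexes induced by a map of modules which is compatible with the given
linear forms; in degree `n` it is `⋀ⁿ f`. -/
def koszulComplexOfForm.map {A : Type u} [CommRing A] {M N : Type u} [AddCommGroup M] [Module A M]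
    [AddCommGroup N] [Module A N] (φ : Module.Dual A M) (ψ : Module.Dual A N) (f : M →ₗ[A] N)
    (h : ψ ∘ₗ f = φ) : koszulComplexOfForm φ ⟶ koszulComplexOfForm ψ :=
  ChainComplex.ofHom (X := koszulComplexOfForm φ) (Y := koszulComplexOfForm ψ)
    (fun n => ModuleCat.ofHom (exteriorPower.map n f))
    (fun n => by
      simp only [koszulComplexOfForm, ChainComplex.of_d]
      refine ModuleCat.hom_ext (LinearMap.ext fun x => Subtype.ext ?_)
      have h1 := coe_exteriorPower_map f n (koszulDifferential φ n x)
      have h2 := map_contractLeft h (x : ExteriorAlgebra A M)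
      rw [← coe_exteriorPower_map f (n + 1) x] at h2
      exact (h1.trans h2).symm)

/-- The Koszul complex `K(A; a₁, …, aₚ)` of a finite sequence: the exterior algebra on
`x₁, …, xₚ`, with `d(xᵢ) = aᵢ`. -/
def koszulComplex {A : Type u} [CommRing A] {p : ℕ} (a : Fin p → A) :
    ChainComplex (ModuleCat.{u} A) ℕ :=
  koszulComplexOfForm (Fintype.linearCombination A a)

/-- The transition map `K(A; a^{j₁}) → K(A; a^{j₀})` for `j₀ ≤ j₁`; it is the map of exterior
algebras with `xᵢ ↦ aᵢ^{j₁ - j₀} xᵢ`. -/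
def koszulComplex.transition {A : Type u} [CommRing A] {p : ℕ} (a : Fin p → A) {j₀ j₁ : ℕ}
    (h : j₀ ≤ j₁) :
    koszulComplex (fun i => a i ^ j₁) ⟶ koszulComplex (fun i => a i ^ j₀) :=
  koszulComplexOfForm.map _ _
    (LinearMap.pi fun i => (a i ^ (j₁ - j₀)) • LinearMap.proj (R := A) i) (by
      refine LinearMap.ext fun v => ?_
      simp only [LinearMap.comp_apply, Fintype.linearCombination_apply, LinearMap.pi_apply,
        LinearMap.smul_apply, LinearMap.proj_apply, smul_eq_mul]
      refine Finset.sum_congr rfl fun i _ => ?_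
      rw [← pow_sub_mul_pow (a i) h]
      ring)

/-! ### Weak proregularity -/

/-- A finite sequence `a` is weakly proregular if for every `n ≥ 1` the inverse system of modules
`H⁻ⁿ(K(A; a^j)) = Hₙ(K(A; a^j))`, `j ≥ 1`, is pro-zero. -/
def IsWeaklyProregularSeq {A : Type u} [CommRing A] {p : ℕ} (a : Fin p → A) : Prop :=
  ∀ n : ℕ, 1 ≤ n → ∀ j₀ : ℕ, 1 ≤ j₀ → ∃ (j₁ : ℕ) (h : j₀ ≤ j₁),
    HomologicalComplex.homologyMap (koszulComplex.transition a h) n = 0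

/-- An ideal is weakly proregular if it is generated by some weakly proregular finite sequence. -/
def Ideal.IsWeaklyProregular {A : Type u} [CommRing A] (𝔞 : Ideal A) : Prop :=
  ∃ (p : ℕ) (_ : 1 ≤ p) (a : Fin p → A), Ideal.span (Set.range a) = 𝔞 ∧ IsWeaklyProregularSeq a

/-! ### Torsion modules and adic flatness -/

/-- A module is `𝔞`-torsion if each of its elements is annihilated by some power of `𝔞`. -/
def Ideal.IsTorsionModule {A : Type u} [CommRing A] (𝔞 : Ideal A) (N : Type u) [AddCommGroup N]
    [Module A N] : Prop :=
  ∀ x : N, ∃ i : ℕ, 1 ≤ i ∧ ∀ r ∈ 𝔞 ^ i, r • x = 0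

/-- A module `P` is `𝔞`-adically flat if `Tor_i(P, N) = 0` for all `𝔞`-torsion modules `N` and all
`i > 0`. -/
def Ideal.IsAdicallyFlat {A : Type u} [CommRing A] (𝔞 : Ideal A) (P : Type u) [AddCommGroup P]
    [Module A P] : Prop :=
  ∀ (N : Type u) [AddCommGroup N] [Module A N], 𝔞.IsTorsionModule N → ∀ i : ℕ, 0 < i →
    Limits.IsZero (((Tor (ModuleCat.{u} A) i).obj (ModuleCat.of A P)).obj (ModuleCat.of A N))

/-- The functor `P ⊗ (-)` is exact on `𝔞`-torsion modules: it preserves the exactness of all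
sequences `N' → N → N''` of `𝔞`-torsion modules. -/
def Ideal.IsTensorExactOnTorsion {A : Type u} [CommRing A] (𝔞 : Ideal A) (P : Type u)
    [AddCommGroup P] [Module A P] : Prop :=
  ∀ (N' N N'' : Type u) [AddCommGroup N'] [Module A N'] [AddCommGroup N] [Module A N]
    [AddCommGroup N''] [Module A N''], 𝔞.IsTorsionModule N' → 𝔞.IsTorsionModule N →
    𝔞.IsTorsionModule N'' → ∀ (f : N' →ₗ[A] N) (g : N →ₗ[A] N''), Function.Exact f g →
      Function.Exact (f.lTensor P) (g.lTensor P)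

end

/-! The substantial implication is (iii) ⇒ (i). Let `N` be killed by `𝔞 ^ q`, with projective
resolution `G`; each `a_l ^ q` then acts null-homotopically on `G`. Two pro-vanishing statements are
combined along `0 → 𝔞^{k+1}P → P → P_k → 0`. For a module `M` whose higher Koszul homology is
pro-zero, the systems `Tor_i(𝔞^m M, N)` are pro-zero (`exists_homologyNull_pow_smul_top`): the
ideals `(a_1^j, …, a_p^j)` are cofinal with the powers of `𝔞`, and `(a_1^j, …, a_p^j)M` is the
module of degree-0 boundaries of `M ⊗ K(A; a^j)`, which is pro-resolved by the terms of positive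
degree. With `M = A`, the system `Tor_{i+1}(A_m, N)` is pro-zero, and flatness of `P_m` over `A_m`
carries this to `Tor_{i+1}(P_m, N)`. With `M = P`, the system `Tor_{i+1}(𝔞^m P, N)` is pro-zero.
Together they make the identity of `Tor_{i+1}(P, N)` zero. The second use needs the Koszul homology
of `P` itself to be pro-zero. The same argument, with `G` replaced by a Koszul complex, gives this
modulo powers of `𝔞`, and completeness of `P` permits passing to the limit
(`isKoszulProzero_of_approx`). A general torsion module is the union of its submodules killed by
powers of `𝔞`; dimension shifting in `P` reduces that case to an injectivity statement. For (i) ⇒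
(ii) only `Tor_1` matters, and (ii) ⇒ (iii) holds because ideals of `A_k` are `𝔞`-torsion. To avoid
homology objects, everything is phrased through cycles and boundaries by `HomologyNull`. -/

noncomputable section

/-! ### Vanishing of maps between homology modules with coefficients -/

section HomologyNull

variable {A : Type u} [CommRing A] {C D E : ChainComplex (ModuleCat.{u} A) ℕ}
variable {M N L : Type u} [AddCommGroup M] [Module A M] [AddCommGroup N] [Module A N]
  [AddCommGroup L] [Module A L]

/-- The map `Hᵢ(M ⊗ C) → Hᵢ(N ⊗ D)` induced by `f : M → N` and `φ : C → D` is zero. -/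
def HomologyNull (φ : C ⟶ D) (f : M →ₗ[A] N) (i : ℕ) : Prop :=
  -- For `i = 0` truncated subtraction gives `C.d 0 0 = 0`, so every `z` counts as a cycle.
  ∀ z : M ⊗[A] C.X i, (C.d i (i - 1)).hom.lTensor M z = 0 →
    ∃ w : N ⊗[A] D.X (i + 1),
      (D.d (i + 1) i).hom.lTensor N w = TensorProduct.map f (φ.f i).hom z

theorem lTensor_d_map (φ : C ⟶ D) (f : M →ₗ[A] N) (i j : ℕ) (z : M ⊗[A] C.X i) :
    (D.d i j).hom.lTensor N (TensorProduct.map f (φ.f i).hom z) =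
      TensorProduct.map f (φ.f j).hom ((C.d i j).hom.lTensor M z) := by
  have h : (D.d i j).hom ∘ₗ (φ.f i).hom = (φ.f j).hom ∘ₗ (C.d i j).hom := by
    rw [← ModuleCat.hom_comp, ← ModuleCat.hom_comp, φ.comm]
  simp only [LinearMap.lTensor, ← LinearMap.comp_apply, ← TensorProduct.map_comp, h,
    LinearMap.id_comp, LinearMap.comp_id]

theorem lTensor_d_rTensor (f : M →ₗ[A] N) (i j : ℕ) (z : M ⊗[A] C.X i) :
    (C.d i j).hom.lTensor N (f.rTensor (C.X i) z) =
      f.rTensor (C.X j) ((C.d i j).hom.lTensor M z) :=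
  lTensor_d_map (𝟙 C) f i j z

theorem lTensor_d_d (i j k : ℕ) (z : M ⊗[A] C.X i) :
    (C.d j k).hom.lTensor M ((C.d i j).hom.lTensor M z) = 0 := by
  rw [← LinearMap.lTensor_comp_apply, ← ModuleCat.hom_comp, C.d_comp_d]
  simp

theorem homologyNull_id_iff {f : M →ₗ[A] N} {i : ℕ} :
    HomologyNull (𝟙 C) f i ↔ ∀ z : M ⊗[A] C.X i, (C.d i (i - 1)).hom.lTensor M z = 0 →
      ∃ w : N ⊗[A] C.X (i + 1), (C.d (i + 1) i).hom.lTensor N w = f.rTensor (C.X i) z :=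
  Iff.rfl

theorem HomologyNull.comp {φ : C ⟶ D} {f : M →ₗ[A] N} {i : ℕ} (h : HomologyNull φ f i)
    (ψ : D ⟶ E) (g : N →ₗ[A] L) : HomologyNull (φ ≫ ψ) (g ∘ₗ f) i := by
  intro z hz
  obtain ⟨w, hw⟩ := h z hz
  refine ⟨TensorProduct.map g (ψ.f _).hom w, ?_⟩
  rw [lTensor_d_map, hw, HomologicalComplex.comp_f, ModuleCat.hom_comp, TensorProduct.map_comp,
    LinearMap.comp_apply]

theorem HomologyNull.precomp {φ : D ⟶ E} {f : N →ₗ[A] L} {i : ℕ} (h : HomologyNull φ f i)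
    (ψ : C ⟶ D) (g : M →ₗ[A] N) : HomologyNull (ψ ≫ φ) (f ∘ₗ g) i := by
  intro z hz
  obtain ⟨w, hw⟩ := h (TensorProduct.map g (ψ.f _).hom z) (by rw [lTensor_d_map, hz, map_zero])
  refine ⟨w, ?_⟩
  rw [hw, HomologicalComplex.comp_f, ModuleCat.hom_comp, TensorProduct.map_comp,
    LinearMap.comp_apply]

theorem HomologyNull.comp_coeff {φ : C ⟶ D} {f : M →ₗ[A] N} {i : ℕ} (h : HomologyNull φ f i)
    (g : N →ₗ[A] L) : HomologyNull φ (g ∘ₗ f) i := by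
  simpa using h.comp (𝟙 D) g

theorem HomologyNull.precomp_coeff {φ : C ⟶ D} {f : N →ₗ[A] L} {i : ℕ} (h : HomologyNull φ f i)
    (g : M →ₗ[A] N) : HomologyNull φ (f ∘ₗ g) i := by
  simpa using h.precomp (𝟙 C) g

theorem HomologyNull.add {φ : C ⟶ D} {f g : M →ₗ[A] N} {i : ℕ} (hf : HomologyNull φ f i)
    (hg : HomologyNull φ g i) : HomologyNull φ (f + g) i := by
  intro z hz
  obtain ⟨w, hw⟩ := hf z hz
  obtain ⟨v, hv⟩ := hg z hz
  exact ⟨w + v, by rw [map_add, hw, hv, TensorProduct.map_add_left, LinearMap.add_apply]⟩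

theorem homologyNull_zero (φ : C ⟶ D) (i : ℕ) : HomologyNull φ (0 : M →ₗ[A] N) i :=
  fun z _ => ⟨0, by simp⟩

/-- In a map of short exact sequences of coefficients, the map on the quotients vanishes on
homology in degree `i + 1` if it is composed of two maps, the first of which vanishes on the
subobjects in degree `i`, and the second in the middle in degree `i + 1`. -/
theorem HomologyNull.of_exact_right {φ : C ⟶ D} {i : ℕ} [Module.Flat A (C.X (i - 1))]
    {X Y Z X' Y' Z' Y'' Z'' : Type u} [AddCommGroup X] [Module A X] [AddCommGroup Y] [Module A Y]
    [AddCommGroup Z] [Module A Z] [AddCommGroup X'] [Module A X'] [AddCommGroup Y'] [Module A Y']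
    [AddCommGroup Z'] [Module A Z'] [AddCommGroup Y''] [Module A Y'']
    [AddCommGroup Z''] [Module A Z'']
    {ι : X →ₗ[A] Y} {π : Y →ₗ[A] Z} {ι' : X' →ₗ[A] Y'} {π' : Y' →ₗ[A] Z'} {π'' : Y'' →ₗ[A] Z''}
    {fX : X →ₗ[A] X'} {fY : Y →ₗ[A] Y'} {fZ : Z →ₗ[A] Z'} {gY : Y' →ₗ[A] Y''} {gZ : Z' →ₗ[A] Z''}
    (hι : Function.Injective ι) (hιπ : Function.Exact ι π) (hπ : Function.Surjective π)
    (hιπ' : π' ∘ₗ ι' = 0) (hX : fY ∘ₗ ι = ι' ∘ₗ fX) (hY : fZ ∘ₗ π = π' ∘ₗ fY)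
    (hZ : gZ ∘ₗ π' = π'' ∘ₗ gY)
    (h : HomologyNull (𝟙 C) fX i) (h' : HomologyNull φ gY (i + 1)) :
    HomologyNull φ (gZ ∘ₗ fZ) (i + 1) := by
  intro z hz
  obtain ⟨y, rfl⟩ := LinearMap.rTensor_surjective (C.X (i + 1)) hπ z
  rw [Nat.add_sub_cancel, lTensor_d_rTensor] at hz
  obtain ⟨x, hx⟩ := (rTensor_exact (C.X i) hιπ hπ _).mp hz
  have hx0 : (C.d i (i - 1)).hom.lTensor X x = 0 := by
    apply Module.Flat.rTensor_preserves_injective_linearMap (M := C.X (i - 1)) ι hι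
    rw [← lTensor_d_rTensor, hx, lTensor_d_d, map_zero]
  obtain ⟨w, hw⟩ := homologyNull_id_iff.mp h x hx0
  -- The image of the connecting class `x` bounds `w`; subtracting `ι' w` turns the image of `y`
  -- into a cycle, and does not change its image under `π'`.
  obtain ⟨v, hv⟩ := h' (fY.rTensor _ y - ι'.rTensor _ w) (by
    rw [Nat.add_sub_cancel, map_sub, lTensor_d_rTensor, lTensor_d_rTensor, hw, ← hx,
      ← LinearMap.rTensor_comp_apply, ← LinearMap.rTensor_comp_apply, hX, sub_self])
  refine ⟨π''.rTensor _ v, ?_⟩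
  rw [lTensor_d_rTensor, hv, map_sub, map_sub]
  simp only [LinearMap.rTensor, ← LinearMap.comp_apply, ← TensorProduct.map_comp, LinearMap.comp_id,
    LinearMap.id_comp]
  rw [← LinearMap.comp_assoc, ← LinearMap.comp_assoc, ← hZ, LinearMap.comp_assoc, ← hY,
    LinearMap.comp_assoc, hιπ']
  simp [LinearMap.comp_assoc]

theorem HomologyNull.of_surjective {φ : C ⟶ D} {X Y X' Y' : Type u} [AddCommGroup X] [Module A X]
    [AddCommGroup Y] [Module A Y] [AddCommGroup X'] [Module A X'] [AddCommGroup Y'] [Module A Y']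
    {π : X →ₗ[A] Y} {π' : X' →ₗ[A] Y'} {g : X →ₗ[A] X'} {g' : Y →ₗ[A] Y'}
    (hπ : Function.Surjective π) (hg : g' ∘ₗ π = π' ∘ₗ g) (h : HomologyNull φ g 0) :
    HomologyNull φ g' 0 := by
  intro z _
  obtain ⟨y, rfl⟩ := LinearMap.rTensor_surjective (C.X 0) hπ z
  obtain ⟨w, hw⟩ := h y (by rw [C.shape _ _ (by simp)]; simp)
  refine ⟨π'.rTensor _ w, ?_⟩
  rw [lTensor_d_rTensor, hw]
  simp only [LinearMap.rTensor, ← LinearMap.comp_apply, ← TensorProduct.map_comp, LinearMap.comp_id,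
    LinearMap.id_comp, hg]

/-- In a map of short exact sequences of coefficients, the map in the middle vanishes on homology
if it is composed of two maps, the first of which vanishes on the quotients, and the second on the
subobjects. -/
theorem HomologyNull.of_exact_middle {i : ℕ} [Module.Flat A (C.X (i - 1))]
    {Y Z X' Y' Z' X'' Y'' : Type u} [AddCommGroup Y] [Module A Y]
    [AddCommGroup Z] [Module A Z] [AddCommGroup X'] [Module A X'] [AddCommGroup Y'] [Module A Y']
    [AddCommGroup Z'] [Module A Z'] [AddCommGroup X''] [Module A X'']
    [AddCommGroup Y''] [Module A Y'']
    {π : Y →ₗ[A] Z} {ι' : X' →ₗ[A] Y'} {π' : Y' →ₗ[A] Z'} {ι'' : X'' →ₗ[A] Y''}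
    {fY : Y →ₗ[A] Y'} {fZ : Z →ₗ[A] Z'} {gX : X' →ₗ[A] X''} {gY : Y' →ₗ[A] Y''}
    (hι : Function.Injective ι') (hιπ : Function.Exact ι' π') (hπ : Function.Surjective π')
    (hX : gY ∘ₗ ι' = ι'' ∘ₗ gX) (hY : fZ ∘ₗ π = π' ∘ₗ fY)
    (h : HomologyNull (𝟙 C) fZ i) (h' : HomologyNull (𝟙 C) gX i) :
    HomologyNull (𝟙 C) (gY ∘ₗ fY) i := by
  rw [homologyNull_id_iff] at *
  intro y hy
  obtain ⟨w, hw⟩ := h (π.rTensor _ y) (by rw [lTensor_d_rTensor, hy, map_zero])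
  obtain ⟨w, rfl⟩ := LinearMap.rTensor_surjective (C.X (i + 1)) hπ w
  rw [lTensor_d_rTensor, ← LinearMap.rTensor_comp_apply, hY, LinearMap.rTensor_comp_apply,
    eq_comm, ← sub_eq_zero, ← map_sub] at hw
  obtain ⟨x, hx⟩ := (rTensor_exact (C.X i) hιπ hπ _).mp hw
  obtain ⟨v, hv⟩ := h' x (by
    apply Module.Flat.rTensor_preserves_injective_linearMap (M := C.X (i - 1)) ι' hι
    rw [← lTensor_d_rTensor, hx, map_sub, lTensor_d_d, lTensor_d_rTensor, hy]
    simp)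
  refine ⟨gY.rTensor _ w + ι''.rTensor _ v, ?_⟩
  rw [map_add, lTensor_d_rTensor, lTensor_d_rTensor, hv, ← LinearMap.rTensor_comp_apply, ← hX,
    LinearMap.rTensor_comp_apply, hx, map_sub, LinearMap.rTensor_comp_apply]
  abel

end HomologyNull

/-! ### Elementary properties of Koszul complexes -/

section Koszul

variable {A : Type u} [CommRing A] {p : ℕ} (a : Fin p → A)

instance koszulComplex_free (n : ℕ) : Module.Free A ((koszulComplex a).X n) :=
  inferInstanceAs (Module.Free A (⋀[A]^n (Fin p → A)))

instance koszulComplex_finite (n : ℕ) : Module.Finite A ((koszulComplex a).X n) :=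
  inferInstanceAs (Module.Finite A (⋀[A]^n (Fin p → A)))

theorem koszulComplexOfForm_d {M : Type u} [AddCommGroup M] [Module A M] (φ : Module.Dual A M)
    (n : ℕ) : (koszulComplexOfForm φ).d (n + 1) n = ModuleCat.ofHom (koszulDifferential φ n) := by
  simp only [koszulComplexOfForm, ChainComplex.of_d]

theorem koszulComplex_d (n : ℕ) :
    (koszulComplex a).d (n + 1) n =
      ModuleCat.ofHom (koszulDifferential (Fintype.linearCombination A a) n) :=
  koszulComplexOfForm_d _ _

theorem koszulComplex.transition_comp {j₀ j₁ j₂ : ℕ} (h : j₀ ≤ j₁) (h' : j₁ ≤ j₂) :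
    koszulComplex.transition a h' ≫ koszulComplex.transition a h =
      koszulComplex.transition a (h.trans h') := by
  ext n : 1
  refine ModuleCat.hom_ext ?_
  change exteriorPower.map n _ ∘ₗ exteriorPower.map n _ = exteriorPower.map n _
  rw [← exteriorPower.map_comp]
  refine congrArg (exteriorPower.map n) (LinearMap.ext fun v => funext fun i => ?_)
  simp only [LinearMap.comp_apply, LinearMap.pi_apply, LinearMap.smul_apply, LinearMap.proj_apply,
    smul_eq_mul, ← mul_assoc, ← pow_add]
  congr 2
  omega

theorem zeroEquiv_koszulDifferential {M : Type u} [AddCommGroup M] [Module A M]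
    (φ : Module.Dual A M) (x : ⋀[A]^1 M) :
    exteriorPower.zeroEquiv A M (koszulDifferential φ 0 x) =
      φ (exteriorPower.oneEquiv A M x) := by
  suffices h : (exteriorPower.zeroEquiv A M).toLinearMap ∘ₗ koszulDifferential φ 0 =
      φ ∘ₗ (exteriorPower.oneEquiv A M).toLinearMap from LinearMap.congr_fun h x
  ext v
  have h : koszulDifferential φ 0 (exteriorPower.ιMulti A 1 v) =
      φ (v 0) • exteriorPower.ιMulti A 0 (Matrix.vecTail v) := by
    refine Subtype.ext ?_
    change CliffordAlgebra.contractLeft φ (ExteriorAlgebra.ιMulti A 1 v) =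
      φ (v 0) • ExteriorAlgebra.ιMulti A 0 (Matrix.vecTail v)
    rw [ExteriorAlgebra.ιMulti_succ_apply, ExteriorAlgebra.ι, CliffordAlgebra.contractLeft_ι_mul,
      ExteriorAlgebra.ιMulti_zero_apply, CliffordAlgebra.contractLeft_one, mul_zero, sub_zero]
  simp [h]

/-- The identification of `M ⊗ K₀(A; a)` with `M`. -/
def koszulComplex.tensorZeroEquiv (M : Type u) [AddCommGroup M] [Module A M] :
    M ⊗[A] (koszulComplex a).X 0 ≃ₗ[A] M :=
  (exteriorPower.zeroEquiv A (Fin p → A)).lTensor M ≪≫ₗ TensorProduct.rid A M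

theorem koszulComplex.tensorZeroEquiv_transition (M : Type u) [AddCommGroup M] [Module A M]
    {j₀ j₁ : ℕ} (h : j₀ ≤ j₁) (x : M ⊗[A] (koszulComplex fun i => a i ^ j₁).X 0) :
    tensorZeroEquiv (fun i => a i ^ j₀) M (((transition a h).f 0).hom.lTensor M x) =
      tensorZeroEquiv (fun i => a i ^ j₁) M x := by
  induction x using TensorProduct.induction_on with
  | zero => simp
  | add x y hx hy => simp only [map_add, hx, hy]
  | tmul m y =>
    have := LinearMap.congr_fun (exteriorPower.zeroEquiv_naturality
      (LinearMap.pi fun i => (a i ^ (j₁ - j₀)) • LinearMap.proj (R := A) (φ := fun _ => A) i)) y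
    exact congrArg (fun r : A => r • m) this

/-- This links Koszul boundaries with adic filtrations: in degree 0 they form the submodule
generated by the products `a_l • m`. -/
theorem koszulComplex.map_range_d_one (M : Type u) [AddCommGroup M] [Module A M] :
    (LinearMap.range (((koszulComplex a).d 1 0).hom.lTensor M)).map
      (tensorZeroEquiv a M).toLinearMap = Ideal.span (Set.range a) • (⊤ : Submodule A M) := by
  have key (m : M) (y : (koszulComplex a).X 1) :
      tensorZeroEquiv a M (((koszulComplex a).d 1 0).hom.lTensor M (m ⊗ₜ y)) =
        Fintype.linearCombination A a (exteriorPower.oneEquiv A (Fin p → A) y) • m := by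
    rw [koszulComplex_d]
    exact congrArg (fun r : A => r • m) (zeroEquiv_koszulDifferential _ y)
  rw [Ideal.span, ← Fintype.range_linearCombination A]
  apply le_antisymm
  · rintro _ ⟨_, ⟨x, rfl⟩, rfl⟩
    induction x using TensorProduct.induction_on with
    | zero => simp
    | add x y hx hy => simpa only [map_add] using add_mem hx hy
    | tmul m y =>
      refine (key m y).symm ▸ Submodule.smul_mem_smul (LinearMap.mem_range_self _ _) trivial
  · rw [Submodule.smul_le]
    rintro _ ⟨v, rfl⟩ m -
    refine ⟨_, ⟨m ⊗ₜ (exteriorPower.oneEquiv A (Fin p → A)).symm v, rfl⟩, (key _ _).trans ?_⟩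
    rw [LinearEquiv.apply_symm_apply]

end Koszul

/-! ### Multiplications which vanish on homology -/

section NullHomotopic

variable {A : Type u} [CommRing A]

/-- Multiplication by `r` on the complex `C` is null-homotopic (degree by degree). -/
def IsNullHomotopicSMul (C : ChainComplex (ModuleCat.{u} A) ℕ) (r : A) : Prop :=
  ∀ i, ∃ (s : C.X i →ₗ[A] C.X (i + 1)) (t : C.X (i - 1) →ₗ[A] C.X i),
    ∀ x, r • x = (C.d (i + 1) i).hom (s x) + t ((C.d i (i - 1)).hom x)

theorem IsNullHomotopicSMul.homologyNull {C : ChainComplex (ModuleCat.{u} A) ℕ} {r : A}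
    (h : IsNullHomotopicSMul C r) {M N : Type u} [AddCommGroup M] [Module A M] [AddCommGroup N]
    [Module A N] (f : M →ₗ[A] N) (i : ℕ) : HomologyNull (𝟙 C) (r • f) i := by
  obtain ⟨s, t, hst⟩ := h i
  rw [homologyNull_id_iff]
  intro z hz
  have h' : r • LinearMap.id = (C.d (i + 1) i).hom ∘ₗ s + t ∘ₗ (C.d i (i - 1)).hom :=
    LinearMap.ext hst
  have h'' := LinearMap.congr_fun (congrArg (LinearMap.lTensor M) h') z
  rw [LinearMap.lTensor_add, LinearMap.add_apply, LinearMap.lTensor_comp_apply,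
    LinearMap.lTensor_comp_apply, hz, map_zero, add_zero, LinearMap.lTensor_smul,
    LinearMap.lTensor_id] at h''
  refine ⟨f.rTensor _ (s.lTensor M z), ?_⟩
  rw [lTensor_d_rTensor, ← h'']
  simp

/-- Maps that vanish on homology form a submodule of `M →ₗ[A] N`, and multiples of a null-homotopic
scalar lie in it. -/
theorem homologyNull_of_mem_smul_top {C : ChainComplex (ModuleCat.{u} A) ℕ} {ι : Type*}
    {b : ι → A} (hb : ∀ l, IsNullHomotopicSMul C (b l)) {M N : Type u} [AddCommGroup M]
    [Module A M] [AddCommGroup N] [Module A N] {f : M →ₗ[A] N}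
    (hf : f ∈ Ideal.span (Set.range b) • (⊤ : Submodule A (M →ₗ[A] N))) (i : ℕ) :
    HomologyNull (𝟙 C) f i := by
  induction hf using Submodule.smul_induction_on' with
  | add x _ y _ hx hy => exact hx.add hy
  | smul r hr f _ =>
    induction hr using Submodule.span_induction generalizing f with
    | zero => rw [zero_smul]; exact homologyNull_zero _ _
    | add x y _ _ hx hy => rw [add_smul]; exact (hx f trivial).add (hy f trivial)
    | mem x hx => obtain ⟨l, rfl⟩ := hx; exact (hb l).homologyNull f i
    | smul c x _ hx => rw [smul_eq_mul, mul_comm, mul_smul]; exact hx _ trivial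

theorem LinearMap.mem_ideal_smul_top {E F : Type*} [AddCommGroup E] [Module A E] [AddCommGroup F]
    [Module A F] [Module.Free A E] [Module.Finite A E] {I : Ideal A} {g : E →ₗ[A] F}
    (hg : ∀ x, g x ∈ I • (⊤ : Submodule A F)) : g ∈ I • (⊤ : Submodule A (E →ₗ[A] F)) := by
  have key (l : E →ₗ[A] A) (y : F) (hy : y ∈ I • (⊤ : Submodule A F)) :
      l.smulRight y ∈ I • (⊤ : Submodule A (E →ₗ[A] F)) := by
    induction hy using Submodule.smul_induction_on' with
    | smul r hr m _ =>
      have : l.smulRight (r • m) = r • l.smulRight m := by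
        ext x; simp [smul_smul, mul_comm]
      rw [this]; exact Submodule.smul_mem_smul hr trivial
    | add x _ y _ hx hy =>
      have : l.smulRight (x + y) = l.smulRight x + l.smulRight y := by ext; simp
      rw [this]; exact add_mem hx hy
  let b := Module.Free.chooseBasis A E
  have hsum : g = ∑ v, (b.coord v).smulRight (g (b v)) := by
    ext x
    simp only [LinearMap.sum_apply, LinearMap.smulRight_apply, Module.Basis.coord_apply,
      ← map_smul, ← map_sum, b.sum_repr]
  rw [hsum]
  exact Submodule.sum_mem _ fun v _ => key _ _ (hg _)

/-- A single factor `g (v 0)` lying in `I • ⊤` suffices, by multilinearity. This requires positive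
exterior degree. -/
theorem exteriorPower_map_mem_smul_top {M N : Type*} [AddCommGroup M] [Module A M]
    [AddCommGroup N] [Module A N] {I : Ideal A} {g : M →ₗ[A] N}
    (hg : ∀ x, g x ∈ I • (⊤ : Submodule A N)) (n : ℕ) (x : ⋀[A]^(n + 1) M) :
    exteriorPower.map (n + 1) g x ∈ I • (⊤ : Submodule A (⋀[A]^(n + 1) N)) := by
  have hx : x ∈ Submodule.span A (Set.range (exteriorPower.ιMulti A (n + 1) (M := M))) := by
    rw [exteriorPower.ιMulti_span]; trivial
  induction hx using Submodule.span_induction with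
  | zero => simp
  | add x y _ _ hx hy => rw [map_add]; exact add_mem hx hy
  | smul r x _ hx => rw [map_smul]; exact Submodule.smul_mem _ r hx
  | mem x hx =>
    obtain ⟨v, rfl⟩ := hx
    rw [exteriorPower.map_apply_ιMulti]
    let L := (exteriorPower.ιMulti A (n + 1)).toMultilinearMap.toLinearMap (g ∘ v) 0
    have hL : exteriorPower.ιMulti A (n + 1) (g ∘ v) = L (g (v 0)) := by
      simp only [L, MultilinearMap.toLinearMap_apply]
      rw [← Function.comp_apply (f := g), Function.update_eq_self]
      rfl
    rw [hL]
    have := Submodule.mem_map_of_mem (f := L) (hg (v 0))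
    rw [Submodule.map_smul''] at this
    exact Submodule.smul_mono le_rfl le_top this

variable {p : ℕ} (a : Fin p → A)

/-- In positive degree the transition is a matrix with entries in `(a_1^q, …, a_p^q)`, and each `a_l
^ q` is null-homotopic on `C`. In degree 0 the transition is the identity, so this fails there in
general. -/
theorem koszulComplex.transition_homologyNull {C : ChainComplex (ModuleCat.{u} A) ℕ} {q : ℕ}
    (hC : ∀ l, IsNullHomotopicSMul C (a l ^ q)) (M : Type u) [AddCommGroup M] [Module A M]
    (j n i : ℕ) :
    HomologyNull (𝟙 C) (((transition a (Nat.le_add_right j q)).f (n + 1)).hom.lTensor M) i := by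
  refine homologyNull_of_mem_smul_top hC ?_ i
  have h : ((transition a (Nat.le_add_right j q)).f (n + 1)).hom ∈
      Ideal.span (Set.range fun l => a l ^ q) • (⊤ : Submodule A
        ((koszulComplex fun i => a i ^ (j + q)).X (n + 1) →ₗ[A]
          (koszulComplex fun i => a i ^ j).X (n + 1))) := by
    refine LinearMap.mem_ideal_smul_top fun x => ?_
    refine exteriorPower_map_mem_smul_top (fun v => ?_) n x
    rw [← Finset.univ_sum_single (LinearMap.pi _ v)]
    refine Submodule.sum_mem _ fun l _ => ?_
    rw [LinearMap.pi_apply, LinearMap.smul_apply, LinearMap.proj_apply, Nat.add_sub_cancel_left,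
      Pi.single_smul']
    exact Submodule.smul_mem_smul (Ideal.subset_span ⟨l, rfl⟩) trivial
  have := Submodule.mem_map_of_mem (f := LinearMap.lTensorHom M) h
  rw [Submodule.map_smul''] at this
  exact Submodule.smul_mono le_rfl le_top this

/-- The homotopy is left multiplication by `m`: contraction is an antiderivation, so `d(m ∧ x) + m ∧
dx = φ(m) x`. -/
theorem koszulComplexOfForm_isNullHomotopicSMul {M : Type u} [AddCommGroup M] [Module A M]
    (φ : Module.Dual A M) (m : M) : IsNullHomotopicSMul (koszulComplexOfForm φ) (φ m) := by
  let s (n : ℕ) : ⋀[A]^n M →ₗ[A] ⋀[A]^(n + 1) M :=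
    (LinearMap.mulLeft A (ExteriorAlgebra.ι A m)).restrict fun x hx => by
      rw [ExteriorAlgebra.exteriorPower, pow_succ']
      exact Submodule.mul_mem_mul (LinearMap.mem_range_self _ _) hx
  have hd (n : ℕ) (x : ⋀[A]^n M) : ((koszulDifferential φ n (s n x) : ⋀[A]^n M) :
      ExteriorAlgebra A M) = φ m • (x : ExteriorAlgebra A M) -
        ExteriorAlgebra.ι A m * CliffordAlgebra.contractLeft φ (x : ExteriorAlgebra A M) :=
    CliffordAlgebra.contractLeft_ι_mul _ _ _
  intro i
  have hdi : (koszulComplexOfForm φ).d (i + 1) i = ModuleCat.ofHom (koszulDifferential φ i) :=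
    koszulComplexOfForm_d _ _
  cases i with
  | zero =>
    refine ⟨s 0, 0, fun x => ?_⟩
    rw [hdi, LinearMap.zero_apply, add_zero]
    refine Subtype.ext (Eq.symm ((hd 0 x).trans ?_))
    have : CliffordAlgebra.contractLeft φ (x.1 : ExteriorAlgebra A M) = 0 := by
      obtain ⟨r, hr⟩ := Submodule.mem_one.mp
        (show (x.1 : ExteriorAlgebra A M) ∈ (1 : Submodule A (ExteriorAlgebra A M)) from x.2)
      rw [← hr]
      exact CliffordAlgebra.contractLeft_algebraMap _ _ _
    rw [this, mul_zero, sub_zero]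
    rfl
  | succ n =>
    refine ⟨s (n + 1), s n, fun x => ?_⟩
    have hdn : (koszulComplexOfForm φ).d (n + 1) n = ModuleCat.ofHom (koszulDifferential φ n) :=
      koszulComplexOfForm_d _ _
    have e₁ : ((koszulComplexOfForm φ).d (n + 1 + 1) (n + 1)).hom (s (n + 1) x) =
        koszulDifferential φ (n + 1) (s (n + 1) x) := by rw [hdi]; rfl
    have e₂ : ((koszulComplexOfForm φ).d (n + 1) n).hom x = koszulDifferential φ n x := by
      rw [hdn]; rfl
    refine Eq.trans ?_ (congrArg₂ (· + ·) e₁.symm (congrArg (s n) e₂.symm))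
    refine Subtype.ext (Eq.symm ?_)
    exact (congrArg (· + _) (hd (n + 1) x)).trans (sub_add_cancel _ _)

theorem koszulComplex_isNullHomotopicSMul (l : Fin p) :
    IsNullHomotopicSMul (koszulComplex a) (a l) := by
  have := koszulComplexOfForm_isNullHomotopicSMul (Fintype.linearCombination A a) (Pi.single l 1)
  rwa [Fintype.linearCombination_apply_single, one_smul] at this

/-- Multiplication by `r` on the resolution lifts the zero map of `N`, and such lifts are
null-homotopic. -/
theorem projectiveResolution_isNullHomotopicSMul {N : ModuleCat.{u} A}
    (G : ProjectiveResolution N) {r : A} (hr : ∀ x : N, r • x = 0) :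
    IsNullHomotopicSMul G.complex r := by
  have h0 : (r • 𝟙 G.complex) ≫ G.π = 0 := by
    ext x
    simp only [Linear.smul_comp, Category.id_comp,
      HomologicalComplex.smul_f_apply]
    exact hr _
  let H := ProjectiveResolution.liftHomotopyZero (r • 𝟙 G.complex) h0
  intro i
  refine ⟨(H.hom i (i + 1)).hom, (H.hom (i - 1) i).hom, fun x => ?_⟩
  have hi := H.comm i
  cases i with
  | zero =>
    rw [Homotopy.prevD_chainComplex, Homotopy.dNext_zero_chainComplex] at hi
    have := congrArg (fun f => f.hom x) hi
    have h2 : (G.complex.d 0 (0 - 1)) = 0 := G.complex.shape _ _ (by simp)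
    rw [h2]
    simpa using this
  | succ n =>
    rw [Homotopy.prevD_chainComplex, Homotopy.dNext_succ_chainComplex] at hi
    have := congrArg (fun f => f.hom x) hi
    rw [add_comm (DFunLike.coe _ _)]
    simpa using this

end NullHomotopic

/-! ### Weak proregularity in terms of elements -/

theorem exists_d_eq_of_homologyMap_eq_zero {A : Type u} [CommRing A]
    {C D : ChainComplex (ModuleCat.{u} A) ℕ} {φ : C ⟶ D} {n : ℕ}
    (h : HomologicalComplex.homologyMap φ n = 0) (z : C.X n) (hz : (C.d n (n - 1)).hom z = 0) :
    ∃ w : D.X (n + 1), (D.d (n + 1) n).hom w = (φ.f n).hom z := by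
  -- The element `z` is encoded as a morphism from `A`, so that it can be lifted to the cycles
  -- object and evaluated at `1`.
  let k : ModuleCat.of A A ⟶ C.X n := ModuleCat.ofHom (LinearMap.toSpanSingleton A _ z)
  have hn : (ComplexShape.down ℕ).next n = n - 1 := by cases n <;> simp
  have hk : k ≫ C.d n (n - 1) = 0 := by
    ext
    simpa [k] using hz
  have h1 : HomologicalComplex.liftCycles C k _ hn hk ≫ HomologicalComplex.cyclesMap φ n ≫
      HomologicalComplex.homologyπ D n = 0 := by
    rw [← HomologicalComplex.homologyπ_naturality, h, Limits.comp_zero, Limits.comp_zero]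
  have hex := ShortComplex.exact_of_g_is_cokernel
    (ShortComplex.mk (D.toCycles (n + 1) n) (D.homologyπ n) (by simp))
    (HomologicalComplex.homologyIsCokernel D (n + 1) n (by simp))
  rw [ShortComplex.moduleCat_exact_iff] at hex
  obtain ⟨w, hw⟩ := hex ((HomologicalComplex.liftCycles C k _ hn hk ≫
    HomologicalComplex.cyclesMap φ n).hom (1 : A)) (by
      have := congrArg (fun f => f.hom (1 : A)) h1
      simpa using this)
  refine ⟨w, ?_⟩
  have := congrArg (D.iCycles n).hom hw
  rw [← LinearMap.comp_apply, ← LinearMap.comp_apply, ← ModuleCat.hom_comp,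
    ← ModuleCat.hom_comp] at this
  simpa [k] using this

theorem IsWeaklyProregularSeq.homologyNull {A : Type u} [CommRing A] {p : ℕ} {a : Fin p → A}
    (ha : IsWeaklyProregularSeq a) {n : ℕ} (hn : 1 ≤ n) {j₀ : ℕ} (hj : 1 ≤ j₀) :
    ∃ (j₁ : ℕ) (h : j₀ ≤ j₁),
      HomologyNull (koszulComplex.transition a h) (LinearMap.id : A →ₗ[A] A) n := by
  obtain ⟨j₁, h, hnull⟩ := ha n hn j₀ hj
  refine ⟨j₁, h, fun z hz => ?_⟩
  have hlid {X Y : Type u} [AddCommGroup X] [Module A X] [AddCommGroup Y] [Module A Y]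
      (f : X →ₗ[A] Y) (x : X) : f.lTensor A (1 ⊗ₜ x) = 1 ⊗ₜ f x := LinearMap.lTensor_tmul _ _ _ _
  obtain ⟨z, rfl⟩ := (TensorProduct.lid A _).symm.surjective z
  rw [TensorProduct.lid_symm_apply] at hz ⊢
  rw [hlid] at hz
  obtain ⟨w, hw⟩ := exists_d_eq_of_homologyMap_eq_zero hnull z
    ((TensorProduct.lid A _).symm.injective (by
      rw [TensorProduct.lid_symm_apply, hz, map_zero]))
  exact ⟨1 ⊗ₜ w, by rw [hlid, hw, TensorProduct.map_tmul, LinearMap.id_apply]⟩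

/-! ### Powers of the ideal and homology -/

section KoszulProzero

variable {A : Type u} [CommRing A] {p : ℕ} (a : Fin p → A)

/-- The inverse systems of the modules `Hₙ(M ⊗ K(A; a^j))`, `n ≥ 1`, are pro-zero. -/
def IsKoszulProzero (M : Type u) [AddCommGroup M] [Module A M] : Prop :=
  ∀ n : ℕ, 1 ≤ n → ∀ j₀ : ℕ, 1 ≤ j₀ → ∃ (j₁ : ℕ) (h : j₀ ≤ j₁),
    HomologyNull (koszulComplex.transition a h) (LinearMap.id : M →ₗ[A] M) n

variable (M : Type u) [AddCommGroup M] [Module A M]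

/-- The boundaries of degree `n` in `M ⊗ K(A; a^j)`. -/
def koszulBoundaries (j n : ℕ) : Submodule A (M ⊗[A] (koszulComplex fun i => a i ^ j).X n) :=
  LinearMap.range (((koszulComplex fun i => a i ^ j).d (n + 1) n).hom.lTensor M)

/-- The cycles of degree `n + 1` in `M ⊗ K(A; a^j)`. -/
def koszulCycles (j n : ℕ) : Submodule A (M ⊗[A] (koszulComplex fun i => a i ^ j).X (n + 1)) :=
  LinearMap.ker (((koszulComplex fun i => a i ^ j).d (n + 1) n).hom.lTensor M)

variable {j₀ j₁ j₂ : ℕ}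

theorem lTensor_d_transition (h : j₀ ≤ j₁) (m n : ℕ)
    (x : M ⊗[A] (koszulComplex fun i => a i ^ j₁).X m) :
    ((koszulComplex fun i => a i ^ j₀).d m n).hom.lTensor M
      (((koszulComplex.transition a h).f m).hom.lTensor M x) =
    ((koszulComplex.transition a h).f n).hom.lTensor M
      (((koszulComplex fun i => a i ^ j₁).d m n).hom.lTensor M x) :=
  lTensor_d_map (koszulComplex.transition a h) LinearMap.id m n x

theorem lTensor_transition_transition (h : j₀ ≤ j₁) (h' : j₁ ≤ j₂) (n : ℕ)
    (x : M ⊗[A] (koszulComplex fun i => a i ^ j₂).X n) :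
    ((koszulComplex.transition a h).f n).hom.lTensor M
      (((koszulComplex.transition a h').f n).hom.lTensor M x) =
    ((koszulComplex.transition a (h.trans h')).f n).hom.lTensor M x := by
  rw [← koszulComplex.transition_comp a h h', HomologicalComplex.comp_f, ModuleCat.hom_comp,
    LinearMap.lTensor_comp_apply]

/-- The transition maps on boundaries. -/
def koszulBoundaries.transition (h : j₀ ≤ j₁) (n : ℕ) :
    koszulBoundaries a M j₁ n →ₗ[A] koszulBoundaries a M j₀ n :=
  (((koszulComplex.transition a h).f n).hom.lTensor M).restrict (by
    rintro _ ⟨x, rfl⟩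
    exact ⟨_, lTensor_d_transition a M h _ _ x⟩)

/-- The transition maps on cycles. -/
def koszulCycles.transition (h : j₀ ≤ j₁) (n : ℕ) :
    koszulCycles a M j₁ n →ₗ[A] koszulCycles a M j₀ n :=
  (((koszulComplex.transition a h).f (n + 1)).hom.lTensor M).restrict (by
    intro x hx
    rw [koszulCycles, LinearMap.mem_ker] at *
    rw [lTensor_d_transition, hx, map_zero])

variable {a M}

/-- Write `Z` and `B` for cycles and boundaries of `M ⊗ K(A; a^j)`. Induction on `i` uses `0 →
Z_{n+1} → M ⊗ K_{n+1} → B_n → 0`: the middle terms are pro-null on homology, and `Z_{n+1}` agrees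
with `B_{n+1}` up to the pro-zero `H_{n+1}`, which lowers `i` by one and raises `n` by one. -/
theorem koszulBoundaries_homologyNull (hM : IsKoszulProzero a M)
    {C : ChainComplex (ModuleCat.{u} A) ℕ} [∀ i, Module.Flat A (C.X i)] {q : ℕ}
    (hC : ∀ l, IsNullHomotopicSMul C (a l ^ q)) (i n j₀ : ℕ) (hj : 1 ≤ j₀) :
    ∃ (j₁ : ℕ) (h : j₀ ≤ j₁), HomologyNull (𝟙 C) (koszulBoundaries.transition a M h n) i := by
  induction i generalizing n j₀ with
  | zero =>
    refine ⟨j₀ + q, Nat.le_add_right _ _, ?_⟩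
    refine HomologyNull.of_surjective (π' := LinearMap.rangeRestrict _)
      (LinearMap.surjective_rangeRestrict _) ?_
      (koszulComplex.transition_homologyNull a hC M j₀ n 0)
    exact LinearMap.ext fun x => Subtype.ext (lTensor_d_transition a M _ _ _ x).symm
  | succ i ih =>
    -- Starting at `j₀ + q` reserves one last transition, from `j₀ + q` to `j₀`, to kill the
    -- contribution of the middle term.
    obtain ⟨j₂, h₂, hB⟩ := ih (n + 1) (j₀ + q) (by omega)
    obtain ⟨j₃, h₃, hZ⟩ := hM (n + 1) (by omega) j₂ (by omega)
    let ZB : koszulCycles a M j₃ n →ₗ[A] koszulBoundaries a M j₂ (n + 1) :=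
      (((koszulComplex.transition a h₃).f (n + 1)).hom.lTensor M).restrict fun x hx => hZ x hx
    let BZ : koszulBoundaries a M (j₀ + q) (n + 1) →ₗ[A] koszulCycles a M (j₀ + q) n :=
      Submodule.inclusion (by
        rintro _ ⟨x, rfl⟩
        exact lTensor_d_d _ _ _ x)
    have hfac : koszulCycles.transition a M (h₂.trans h₃) n =
        BZ ∘ₗ koszulBoundaries.transition a M h₂ (n + 1) ∘ₗ ZB :=
      LinearMap.ext fun x => Subtype.ext (lTensor_transition_transition a M h₂ h₃ _ _).symm
    have hnull : HomologyNull (𝟙 C) (koszulCycles.transition a M (h₂.trans h₃) n) i := by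
      rw [hfac]
      exact (hB.precomp_coeff ZB).comp_coeff BZ
    refine ⟨j₃, (Nat.le_add_right _ _).trans (h₂.trans h₃), ?_⟩
    have hcomp : koszulBoundaries.transition a M ((Nat.le_add_right j₀ q).trans (h₂.trans h₃)) n =
        koszulBoundaries.transition a M (Nat.le_add_right j₀ q) n ∘ₗ
          koszulBoundaries.transition a M (h₂.trans h₃) n :=
      LinearMap.ext fun x => Subtype.ext (lTensor_transition_transition a M _ _ _ _).symm
    rw [hcomp]
    refine HomologyNull.of_exact_right (ι := (koszulCycles a M j₃ n).subtype)
      (ι' := (koszulCycles a M (j₀ + q) n).subtype)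
      (π := LinearMap.rangeRestrict _) (π' := LinearMap.rangeRestrict _)
      (π'' := LinearMap.rangeRestrict _)
      (fY := ((koszulComplex.transition a (h₂.trans h₃)).f (n + 1)).hom.lTensor M)
      (Submodule.subtype_injective _) ?_ (LinearMap.surjective_rangeRestrict _) ?_ ?_ ?_ ?_ hnull
      (koszulComplex.transition_homologyNull a hC M j₀ n (i + 1))
    · refine fun y => ⟨fun hy => ⟨⟨y, congrArg Subtype.val hy⟩, rfl⟩, ?_⟩
      rintro ⟨x, rfl⟩
      exact Subtype.ext x.2
    · exact LinearMap.ext fun x => Subtype.ext x.2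
    · rfl
    · exact LinearMap.ext fun x => Subtype.ext (lTensor_d_transition a M _ _ _ x).symm
    · exact LinearMap.ext fun x => Subtype.ext (lTensor_d_transition a M _ _ _ x).symm

theorem exists_homologyNull_pow_smul_top (hM : IsKoszulProzero a M)
    {C : ChainComplex (ModuleCat.{u} A) ℕ} [∀ i, Module.Flat A (C.X i)] {q : ℕ}
    (hC : ∀ l, IsNullHomotopicSMul C (a l ^ q)) (i k : ℕ) :
    ∃ (m : ℕ) (h : k ≤ m), HomologyNull (𝟙 C) (Submodule.inclusion
      (Submodule.smul_mono_left (Ideal.pow_le_pow_right h) :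
        Ideal.span (Set.range a) ^ m • (⊤ : Submodule A M) ≤
          Ideal.span (Set.range a) ^ k • ⊤)) i := by
  -- The exponent is `k + 1` because Koszul exponents must be positive, while `k` may be 0.
  obtain ⟨j, h, hnull⟩ := koszulBoundaries_homologyNull hM hC i 0 (k + 1) (by omega)
  obtain ⟨m, hm⟩ : ∃ m, Ideal.span (Set.range a) ^ m ≤
      Ideal.span (Set.range fun l => a l ^ j) := by
    refine Ideal.exists_pow_le_of_le_radical_of_fg ?_ (Submodule.fg_span (Set.finite_range a))
    rw [Ideal.span_le]
    rintro _ ⟨l, rfl⟩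
    exact ⟨j, Ideal.subset_span (Set.mem_range_self l)⟩
  have hk : Ideal.span (Set.range fun l => a l ^ (k + 1)) ≤ Ideal.span (Set.range a) ^ k := by
    rw [Ideal.span_le]
    rintro _ ⟨l, rfl⟩
    exact Ideal.pow_le_pow_right (Nat.le_succ k)
      (Ideal.pow_mem_pow (Ideal.subset_span (Set.mem_range_self l)) _)
  refine ⟨max m k, le_max_right _ _, ?_⟩
  let e (j : ℕ) := koszulComplex.tensorZeroEquiv (fun i => a i ^ j) M
  have he (j : ℕ) : (koszulBoundaries a M j 0).map (e j).toLinearMap = _ :=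
    koszulComplex.map_range_d_one (fun i => a i ^ j) M
  let f : (Ideal.span (Set.range a) ^ max m k • (⊤ : Submodule A M) : Submodule A M) →ₗ[A]
      koszulBoundaries a M j 0 :=
    (e j).symm.toLinearMap.restrict (by
      intro x hx
      have hx' := Submodule.smul_mono_left
        ((Ideal.pow_le_pow_right (le_max_left m k)).trans hm) hx
      rw [← he] at hx'
      obtain ⟨y, hy, rfl⟩ := hx'
      simpa using hy)
  let g : koszulBoundaries a M (k + 1) 0 →ₗ[A]
      (Ideal.span (Set.range a) ^ k • (⊤ : Submodule A M) : Submodule A M) :=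
    (e (k + 1)).toLinearMap.restrict (by
      intro x hx
      refine Submodule.smul_mono_left hk ?_
      rw [← he]
      exact Submodule.mem_map_of_mem hx)
  have hfac : Submodule.inclusion (Submodule.smul_mono_left
      (Ideal.pow_le_pow_right (le_max_right m k)) : Ideal.span (Set.range a) ^ max m k •
        (⊤ : Submodule A M) ≤ Ideal.span (Set.range a) ^ k • ⊤) =
      g ∘ₗ koszulBoundaries.transition a M h 0 ∘ₗ f := by
    refine LinearMap.ext fun x => Subtype.ext ?_
    exact ((koszulComplex.tensorZeroEquiv_transition a M h ((e j).symm x.1)).trans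
      ((e j).apply_symm_apply x.1)).symm
  rw [hfac]
  exact (hnull.precomp_coeff f).comp_coeff g

end KoszulProzero

/-! ### Passing from the quotients of the ring to the quotients of the module -/

section BaseChange

variable {A : Type u} [CommRing A]

theorem exists_lTensor_subtype_ker_eq {Q X Y : Type*} [AddCommGroup Q] [Module A Q]
    [AddCommGroup X] [Module A X] [AddCommGroup Y] [Module A Y] [Module.Flat A Q] (d : X →ₗ[A] Y)
    (z : Q ⊗[A] X) (hz : d.lTensor Q z = 0) :
    ∃ t : Q ⊗[A] LinearMap.ker d, (LinearMap.ker d).subtype.lTensor Q t = z :=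
  (Module.Flat.lTensor_exact Q (LinearMap.exact_subtype_ker_map d) z).mp hz

/-- By flatness over `B`, cycles of `(B ⊗ P) ⊗_B (B ⊗ C)` are sums of `x ⊗ ζ` with `ζ` a cycle of `B
⊗ C`. Each of these is the image of `ζ` under the coefficient map `b ↦ b • x`, to which the
hypothesis applies. -/
theorem HomologyNull.rTensor_of_flat {C D : ChainComplex (ModuleCat.{u} A) ℕ} {φ : C ⟶ D}
    {B B' : Type u} [CommRing B] [Algebra A B] [CommRing B'] [Algebra A B'] {ρ : B →ₐ[A] B'}
    (P : Type u) [AddCommGroup P] [Module A P] [Module.Flat B (B ⊗[A] P)] {i : ℕ}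
    (h : HomologyNull φ ρ.toLinearMap i) :
    HomologyNull φ (ρ.toLinearMap.rTensor P) i := by
  intro z hz
  let e (j : ℕ) := AlgebraTensorModule.cancelBaseChange A B B (B ⊗[A] P) (C.X j)
  let d := (C.d i (i - 1)).hom.baseChange B
  have hcomm (y : (B ⊗[A] P) ⊗[B] (B ⊗[A] C.X i)) : e (i - 1) (d.lTensor (B ⊗[A] P) y) =
      (C.d i (i - 1)).hom.lTensor (B ⊗[A] P) (e i y) := by
    induction y using TensorProduct.induction_on with
    | zero => simp
    | add x y hx hy => simp only [map_add, hx, hy]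
    | tmul x y =>
      induction y using TensorProduct.induction_on with
      | zero => simp
      | add y y' hy hy' => simp only [TensorProduct.tmul_add, map_add, hy, hy']
      | tmul b c => simp [d, e]
  obtain ⟨y, rfl⟩ := (e i).surjective z
  rw [← hcomm, LinearEquiv.map_eq_zero_iff] at hz
  obtain ⟨t, rfl⟩ := exists_lTensor_subtype_ker_eq d y hz
  clear hz
  induction t using TensorProduct.induction_on with
  | zero => exact ⟨0, by simp⟩
  | add x y hx hy =>
    obtain ⟨w, hw⟩ := hx
    obtain ⟨v, hv⟩ := hy
    exact ⟨w + v, by simp only [map_add, hw, hv]⟩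
  | tmul x ζ =>
    let μ : B →ₗ[A] B ⊗[A] P := (LinearMap.toSpanSingleton B _ x).restrictScalars A
    let μ' : B' →ₗ[A] B' ⊗[A] P :=
      (LinearMap.toSpanSingleton B' _ (ρ.toLinearMap.rTensor P x)).restrictScalars A
    have hμ : ρ.toLinearMap.rTensor P ∘ₗ μ = μ' ∘ₗ ρ.toLinearMap := by
      ext b
      simp only [μ, μ', LinearMap.comp_apply, LinearMap.restrictScalars_apply,
        LinearMap.toSpanSingleton_apply]
      induction x using TensorProduct.induction_on with
      | zero => simp
      | add x y hx hy => simp only [smul_add, map_add, hx, hy]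
      | tmul c p => simp [TensorProduct.smul_tmul']
    have he (ξ : B ⊗[A] C.X i) : e i (x ⊗ₜ ξ) = μ.rTensor (C.X i) ξ := by
      induction ξ using TensorProduct.induction_on with
      | zero => simp
      | add y y' hy hy' => simp only [TensorProduct.tmul_add, map_add, hy, hy']
      | tmul b c => simp [e, μ]
    have hζ : (C.d i (i - 1)).hom.lTensor B ζ.1 = 0 := ζ.2
    have hmap (ξ : B ⊗[A] C.X i) :
        TensorProduct.map (ρ.toLinearMap.rTensor P) (φ.f i).hom (e i (x ⊗ₜ ξ)) =
          TensorProduct.map (μ' ∘ₗ ρ.toLinearMap) (φ.f i).hom ξ := by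
      rw [he, ← hμ]
      simp only [LinearMap.rTensor, ← LinearMap.comp_apply, ← TensorProduct.map_comp,
        LinearMap.comp_id]
    obtain ⟨w, hw⟩ := h.comp_coeff μ' ζ.1 hζ
    rw [← hmap] at hw
    exact ⟨w, hw⟩

theorem exact_subtype_smul_top_mk (I : Ideal A) (P : Type u) [AddCommGroup P] [Module A P] :
    Function.Exact (I • (⊤ : Submodule A P)).subtype (TensorProduct.mk A (A ⧸ I) P 1) := by
  refine LinearMap.exact_iff.mpr ?_
  rw [Submodule.range_subtype]
  exact LinearMap.ker_tensorProductMk (R := A) (Q := P) (I := I)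

theorem surjective_mk_one (I : Ideal A) (P : Type u) [AddCommGroup P] [Module A P] :
    Function.Surjective (TensorProduct.mk A (A ⧸ I) P 1) := by
  intro x
  induction x using TensorProduct.induction_on with
  | zero => exact ⟨0, map_zero _⟩
  | add x y hx hy =>
    obtain ⟨p, rfl⟩ := hx
    obtain ⟨q, rfl⟩ := hy
    exact ⟨p + q, map_add _ _ _⟩
  | tmul r p =>
    obtain ⟨r, rfl⟩ := Ideal.Quotient.mk_surjective r
    refine ⟨r • p, ?_⟩
    rw [TensorProduct.mk_apply, ← TensorProduct.smul_tmul, Algebra.smul_def, mul_one]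
    rfl

/-- The projection `A ⧸ 𝔞ᵐ⁺¹ → A ⧸ 𝔞ᵏ⁺¹`. -/
def Ideal.quotientPowFactor (𝔞 : Ideal A) {k m : ℕ} (h : k ≤ m) :
    A ⧸ 𝔞 ^ (m + 1) →ₐ[A] A ⧸ 𝔞 ^ (k + 1) :=
  Ideal.Quotient.factorₐ A (Ideal.pow_le_pow_right (Nat.succ_le_succ h))

/-- The sequence `0 → 𝔞^{m+1} → A → A_m → 0` sends a class of degree `i + 1` to one of degree `i`
with coefficients in `𝔞^{m+1}`, which dies in `𝔞^{k+1}`; what remains comes from `A` and is killed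
by `φ`. -/
theorem HomologyNull.quotientPowFactor {C D : ChainComplex (ModuleCat.{u} A) ℕ} {φ : C ⟶ D}
    [∀ i, Module.Flat A (C.X i)] {i : ℕ}
    (hφ : HomologyNull φ (LinearMap.id : A →ₗ[A] A) (i + 1)) (𝔞 : Ideal A)
    (hpow : ∀ k, ∃ (m : ℕ) (h : k ≤ m), HomologyNull (𝟙 C) (Submodule.inclusion
      (Submodule.smul_mono_left (Ideal.pow_le_pow_right h) :
        𝔞 ^ m • (⊤ : Submodule A A) ≤ 𝔞 ^ k • ⊤)) i) (k : ℕ) :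
    ∃ (m : ℕ) (h : k ≤ m), HomologyNull φ (𝔞.quotientPowFactor h).toLinearMap (i + 1) := by
  obtain ⟨m, hm, hnull⟩ := hpow (k + 1)
  obtain ⟨m, rfl⟩ : ∃ m', m = m' + 1 := ⟨m - 1, by omega⟩
  refine ⟨m, by omega, ?_⟩
  have hπ (j : ℕ) : Function.Surjective (Ideal.Quotient.mkₐ A (𝔞 ^ j)).toLinearMap :=
    Ideal.Quotient.mk_surjective
  have hex (j : ℕ) : Function.Exact (𝔞 ^ j • (⊤ : Submodule A A)).subtype
      (Ideal.Quotient.mkₐ A (𝔞 ^ j)).toLinearMap := by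
    rw [LinearMap.exact_iff, Submodule.range_subtype, smul_eq_mul, Ideal.mul_top]
    ext x
    exact Ideal.Quotient.eq_zero_iff_mem
  exact HomologyNull.of_exact_right (fY := LinearMap.id) (gZ := LinearMap.id)
    (ι := (𝔞 ^ (m + 1) • (⊤ : Submodule A A)).subtype)
    (π := (Ideal.Quotient.mkₐ A (𝔞 ^ (m + 1))).toLinearMap)
    (ι' := (𝔞 ^ (k + 1) • (⊤ : Submodule A A)).subtype)
    (π' := (Ideal.Quotient.mkₐ A (𝔞 ^ (k + 1))).toLinearMap)
    (π'' := (Ideal.Quotient.mkₐ A (𝔞 ^ (k + 1))).toLinearMap)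
    (fZ := (𝔞.quotientPowFactor (by omega)).toLinearMap)
    (Submodule.subtype_injective _) (hex (m + 1)) (hπ (m + 1))
    (hex (k + 1)).linearMap_comp_eq_zero
    (LinearMap.ext fun _ => rfl) (LinearMap.ext fun _ => rfl) (LinearMap.ext fun _ => rfl)
    hnull hφ

variable {p : ℕ} {a : Fin p → A}

/-- It serves twice: for `φ` a Koszul transition map, and for `φ` the identity of a projective
resolution of a module killed by `𝔞 ^ q`. -/
theorem exists_homologyNull_rTensor_quotientPowFactor (ha : IsKoszulProzero a A)
    {C D : ChainComplex (ModuleCat.{u} A) ℕ} {φ : C ⟶ D} [∀ i, Module.Flat A (C.X i)] {q : ℕ}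
    (hC : ∀ l, IsNullHomotopicSMul C (a l ^ q)) {i : ℕ}
    (hφ : HomologyNull φ (LinearMap.id : A →ₗ[A] A) (i + 1))
    (P : Type u) [AddCommGroup P] [Module A P]
    (hP : ∀ k : ℕ, Module.Flat (A ⧸ Ideal.span (Set.range a) ^ (k + 1))
      ((A ⧸ Ideal.span (Set.range a) ^ (k + 1)) ⊗[A] P)) (k : ℕ) :
    ∃ (m : ℕ) (h : k ≤ m), HomologyNull φ
      (((Ideal.span (Set.range a)).quotientPowFactor h).toLinearMap.rTensor P) (i + 1) := by
  obtain ⟨m, h, hnull⟩ := hφ.quotientPowFactor _ (exists_homologyNull_pow_smul_top ha hC i) k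
  have := hP m
  exact ⟨m, h, hnull.rTensor_of_flat P⟩

theorem quotientPowFactor_rTensor_mk (𝔞 : Ideal A) {k m : ℕ} (h : k ≤ m) (P : Type u)
    [AddCommGroup P] [Module A P] :
    (𝔞.quotientPowFactor h).toLinearMap.rTensor P ∘ₗ TensorProduct.mk A (A ⧸ 𝔞 ^ (m + 1)) P 1 =
      TensorProduct.mk A (A ⧸ 𝔞 ^ (k + 1)) P 1 := by
  ext x
  simp

/-- Vanishing on homology with coefficients in `P ⧸ 𝔞ᵐ⁺¹P → P ⧸ 𝔞ᵏ⁺¹P`, in terms of elements. -/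
theorem HomologyNull.exists_sub_mem {C D : ChainComplex (ModuleCat.{u} A) ℕ} {φ : C ⟶ D}
    {𝔞 : Ideal A} {P : Type u} [AddCommGroup P] [Module A P] {k m i : ℕ} {h : k ≤ m}
    (hnull : HomologyNull φ ((𝔞.quotientPowFactor h).toLinearMap.rTensor P) i)
    (z : P ⊗[A] C.X i)
    (hz : (C.d i (i - 1)).hom.lTensor P z ∈ 𝔞 ^ (m + 1) • (⊤ : Submodule A _)) :
    ∃ w : P ⊗[A] D.X (i + 1), (φ.f i).hom.lTensor P z - (D.d (i + 1) i).hom.lTensor P w ∈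
      𝔞 ^ (k + 1) • (⊤ : Submodule A (P ⊗[A] D.X i)) := by
  have h₁ {X : Type u} [AddCommGroup X] [Module A X] {j : ℕ} (x : P ⊗[A] X)
      (hx : x ∈ 𝔞 ^ j • (⊤ : Submodule A (P ⊗[A] X))) :
      (TensorProduct.mk A (A ⧸ 𝔞 ^ j) P 1).rTensor X x = 0 := by
    induction hx using Submodule.smul_induction_on' with
    | add x _ y _ hx hy => rw [map_add, hx, hy, add_zero]
    | smul r hr x _ =>
      rw [map_smul, ← LinearMap.smul_apply, ← LinearMap.rTensor_smul]
      have : r • TensorProduct.mk A (A ⧸ 𝔞 ^ j) P 1 = 0 := by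
        refine LinearMap.ext fun p => ?_
        have hr0 : r • (1 : A ⧸ 𝔞 ^ j) = 0 := by
          rw [Algebra.smul_def, mul_one]
          exact Ideal.Quotient.eq_zero_iff_mem.mpr hr
        rw [LinearMap.smul_apply, TensorProduct.mk_apply, TensorProduct.smul_tmul', hr0,
          TensorProduct.zero_tmul, LinearMap.zero_apply]
      rw [this]
      simp
  have h₂ {X : Type u} [AddCommGroup X] [Module A X] {j : ℕ} (x : P ⊗[A] X)
      (hx : (TensorProduct.mk A (A ⧸ 𝔞 ^ j) P 1).rTensor X x = 0) :
      x ∈ 𝔞 ^ j • (⊤ : Submodule A (P ⊗[A] X)) := by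
    obtain ⟨y, rfl⟩ := (rTensor_exact X (exact_subtype_smul_top_mk (𝔞 ^ j) P)
      (surjective_mk_one (𝔞 ^ j) P) x).mp hx
    clear hx
    induction y using TensorProduct.induction_on with
    | zero => simp
    | add x y hx hy => rw [map_add]; exact add_mem hx hy
    | tmul y x =>
      have := Submodule.mem_map_of_mem (f := (TensorProduct.mk A P X).flip x) y.2
      rw [Submodule.map_smul''] at this
      exact Submodule.smul_mono le_rfl le_top this
  obtain ⟨w, hw⟩ := hnull ((TensorProduct.mk A (A ⧸ 𝔞 ^ (m + 1)) P 1).rTensor _ z) (by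
    rw [lTensor_d_rTensor, h₁ _ hz])
  obtain ⟨w, rfl⟩ := LinearMap.rTensor_surjective (D.X (i + 1)) (surjective_mk_one (𝔞 ^ (k + 1)) P) w
  refine ⟨w, h₂ _ ?_⟩
  rw [map_sub, ← lTensor_d_rTensor, hw, sub_eq_zero, ← quotientPowFactor_rTensor_mk 𝔞 h]
  simp only [LinearMap.rTensor, LinearMap.lTensor, ← LinearMap.comp_apply, ← TensorProduct.map_comp,
    LinearMap.comp_id, LinearMap.id_comp]

end BaseChange

/-! ### Complete modules -/

section Complete

variable {A : Type u} [CommRing A]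

theorem mem_smul_top_pi {ι : Type*} [Finite ι] {P : Type*} [AddCommGroup P] [Module A P]
    {I : Ideal A} {x : ι → P} :
    x ∈ I • (⊤ : Submodule A (ι → P)) ↔ ∀ i, x i ∈ I • (⊤ : Submodule A P) := by
  classical
  cases nonempty_fintype ι
  refine ⟨fun hx i => ?_, fun hx => ?_⟩
  · have := Submodule.mem_map_of_mem (f := LinearMap.proj (R := A) i) hx
    rw [Submodule.map_smul''] at this
    exact Submodule.smul_mono le_rfl le_top this
  · rw [← Finset.univ_sum_single x]
    refine Submodule.sum_mem _ fun i _ => ?_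
    have := Submodule.mem_map_of_mem (f := LinearMap.single A (fun _ : ι => P) i) (hx i)
    rw [Submodule.map_smul''] at this
    exact Submodule.smul_mono le_rfl le_top this

theorem LinearEquiv.mem_smul_top_iff {P Q : Type*} [AddCommGroup P] [Module A P] [AddCommGroup Q]
    [Module A Q] (e : P ≃ₗ[A] Q) {I : Ideal A} {x : P} :
    e x ∈ I • (⊤ : Submodule A Q) ↔ x ∈ I • (⊤ : Submodule A P) := by
  have : (I • (⊤ : Submodule A P)).map e.toLinearMap = I • ⊤ := by
    rw [Submodule.map_smul'', Submodule.map_top, LinearEquiv.range]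
  rw [← this]
  exact ⟨fun ⟨y, hy, h⟩ => e.injective h ▸ hy, fun h => Submodule.mem_map_of_mem h⟩

theorem IsAdicComplete.of_linearEquiv_pi {ι : Type*} [Finite ι] {P Q : Type*} [AddCommGroup P]
    [Module A P] [AddCommGroup Q] [Module A Q] {I : Ideal A} [IsAdicComplete I P]
    (e : Q ≃ₗ[A] (ι → P)) : IsAdicComplete I Q where
  haus' x hx := by
    rw [← e.map_eq_zero_iff]
    funext i
    refine IsHausdorff.haus ‹IsAdicComplete I P›.toIsHausdorff _ fun n => ?_
    have h := hx n
    rw [SModEq.sub_mem, sub_zero] at h ⊢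
    exact mem_smul_top_pi.mp (e.mem_smul_top_iff.mpr h) i
  prec' f hf := by
    have h (i : ι) := IsPrecomplete.prec ‹IsAdicComplete I P›.toIsPrecomplete
      (f := fun n => e (f n) i) fun {m n} hmn => by
        have h := hf hmn
        rw [SModEq.sub_mem] at h ⊢
        have := mem_smul_top_pi.mp (e.mem_smul_top_iff.mpr h) i
        rwa [map_sub] at this
    choose L hL using h
    refine ⟨e.symm L, fun n => ?_⟩
    rw [SModEq.sub_mem, ← e.mem_smul_top_iff, map_sub, e.apply_symm_apply, mem_smul_top_pi]
    intro i
    exact SModEq.sub_mem.mp (hL i n)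

theorem IsAdicComplete.tensorProduct {P E : Type*} [AddCommGroup P] [Module A P] [AddCommGroup E]
    [Module A E] [Module.Free A E] [Module.Finite A E] (I : Ideal A) [IsAdicComplete I P] :
    IsAdicComplete I (P ⊗[A] E) := by
  classical
  exact IsAdicComplete.of_linearEquiv_pi
    ((Module.Free.chooseBasis A E).equivFun.lTensor P ≪≫ₗ TensorProduct.piScalarRight A A P _)

/-- A series whose terms lie in the powers of `I` converges. -/
theorem IsPrecomplete.exists_sum_sub_mem {Q : Type*} [AddCommGroup Q] [Module A Q] {I : Ideal A}
    (hQ : IsPrecomplete I Q) {u : ℕ → Q}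
    (hu : ∀ k, u (k + 1) - u k ∈ I ^ k • (⊤ : Submodule A Q)) :
    ∃ L, ∀ k, u k - L ∈ I ^ k • (⊤ : Submodule A Q) := by
  obtain ⟨L, hL⟩ := hQ.prec (f := u) fun {m n} hmn => by
    induction n, hmn using Nat.le_induction with
    | base => rfl
    | succ n hmn ih =>
      refine ih.trans (SModEq.symm (SModEq.sub_mem.mpr ?_))
      exact Submodule.smul_mono_left (Ideal.pow_le_pow_right hmn) (hu n)
  exact ⟨L, fun k => SModEq.sub_mem.mp (hL k)⟩

theorem LinearMap.apply_mem_smul_top {P Q : Type*} [AddCommGroup P] [Module A P] [AddCommGroup Q]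
    [Module A Q] (f : P →ₗ[A] Q) {I : Ideal A} {x : P} (hx : x ∈ I • (⊤ : Submodule A P)) :
    f x ∈ I • (⊤ : Submodule A Q) := by
  have := Submodule.mem_map_of_mem (f := f) hx
  rw [Submodule.map_smul''] at this
  exact Submodule.smul_mono le_rfl le_top this

/-- A Mittag-Leffler argument: approximate bounding chains in degree `n` differ by approximate
cycles in degree `n + 1`, so after one more transition they can be corrected by boundaries to a
Cauchy sequence. It is essential that `j₁` does not depend on `k`. -/
theorem isKoszulProzero_of_approx {p : ℕ} {a : Fin p → A} {P : Type u} [AddCommGroup P]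
    [Module A P] (I : Ideal A) [IsAdicComplete I P]
    (happrox : ∀ n, 1 ≤ n → ∀ j₀, 1 ≤ j₀ → ∃ (j₁ : ℕ) (h : j₀ ≤ j₁), ∀ k, ∃ m, k ≤ m ∧
      ∀ z : P ⊗[A] (koszulComplex fun i => a i ^ j₁).X n,
        ((koszulComplex fun i => a i ^ j₁).d n (n - 1)).hom.lTensor P z ∈
          I ^ m • (⊤ : Submodule A _) →
        ∃ w : P ⊗[A] (koszulComplex fun i => a i ^ j₀).X (n + 1),
          ((koszulComplex.transition a h).f n).hom.lTensor P z -
            ((koszulComplex fun i => a i ^ j₀).d (n + 1) n).hom.lTensor P w ∈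
              I ^ k • (⊤ : Submodule A (P ⊗[A] (koszulComplex fun i => a i ^ j₀).X n))) :
    IsKoszulProzero a P := by
  intro n hn j₀ hj₀
  obtain ⟨j₁, h₁, H₁⟩ := happrox (n + 1) (by omega) j₀ hj₀
  obtain ⟨j₂, h₂, H₂⟩ := happrox n hn j₁ (hj₀.trans h₁)
  refine ⟨j₂, h₁.trans h₂, fun z hz => ?_⟩
  have hw (k : ℕ) := (H₂ k).choose_spec.2 z (by rw [hz]; exact zero_mem _)
  choose w hw using hw
  choose μ hkμ hμ using H₁
  -- Partial sums give a monotone sequence dominating `μ`, so that both `w (ν k)` and `w (ν (k +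
  -- 1))` are accurate modulo `I ^ μ k`.
  let ν (k : ℕ) := ∑ l ∈ Finset.range (k + 1), μ l
  have hν (k : ℕ) : μ k ≤ ν k :=
    Finset.single_le_sum (f := μ) (fun _ _ => Nat.zero_le _) (Finset.self_mem_range_succ k)
  have hν' (k : ℕ) : ν k ≤ ν (k + 1) := by
    simp only [ν]
    rw [Finset.sum_range_succ _ (k + 1)]
    exact Nat.le_add_right _ _
  have hv (k : ℕ) := hμ k (w (ν (k + 1)) - w (ν k)) (by
    rw [Nat.add_sub_cancel, map_sub]
    have h1 := Submodule.smul_mono_left (Ideal.pow_le_pow_right (hν k)) (hw (ν k))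
    have h2 := Submodule.smul_mono_left (Ideal.pow_le_pow_right ((hν k).trans (hν' k)))
      (hw (ν (k + 1)))
    simpa using sub_mem h1 h2)
  choose v hv using hv
  let T := ((koszulComplex.transition a h₁).f (n + 1)).hom.lTensor P
  let d := ((koszulComplex fun i => a i ^ j₀).d (n + 1) n).hom.lTensor P
  let e (k : ℕ) := T (w (ν (k + 1)) - w (ν k)) -
    ((koszulComplex fun i => a i ^ j₀).d (n + 1 + 1) (n + 1)).hom.lTensor P (v k)
  -- The sum telescopes up to boundaries, so `U k` and `T (w (ν k))` have the same differential,
  -- while successive terms differ by `e k`, which lies in `I ^ k • ⊤`.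
  let U (k : ℕ) := T (w (ν 0)) + ∑ l ∈ Finset.range k, e l
  have hdU (k : ℕ) : d (U k) = d (T (w (ν k))) := by
    induction k with
    | zero => simp [U]
    | succ k ih =>
      have : U (k + 1) = U k + e k := by
        simp only [U, Finset.sum_range_succ, add_assoc]
      rw [this, map_add, ih]
      simp only [e, map_sub]
      rw [show d (LinearMap.lTensor P _ (v k)) = 0 from lTensor_d_d _ _ _ _]
      abel
  have := IsAdicComplete.tensorProduct (P := P) (E := (koszulComplex fun i => a i ^ j₀).X (n + 1)) I
  have := IsAdicComplete.tensorProduct (P := P) (E := (koszulComplex fun i => a i ^ j₀).X n) I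
  obtain ⟨L, hL⟩ := IsPrecomplete.exists_sum_sub_mem (I := I) (u := U) inferInstance fun k => by
    have : U (k + 1) - U k = e k := by
      simp only [U, Finset.sum_range_succ]
      abel
    rw [this]
    exact hv k
  refine ⟨L, ?_⟩
  rw [← sub_eq_zero]
  refine IsHausdorff.haus (I := I) inferInstance _ fun k => ?_
  rw [SModEq.sub_mem, sub_zero]
  have h1 := d.apply_mem_smul_top (hL k)
  have h2 := LinearMap.apply_mem_smul_top (((koszulComplex.transition a h₁).f n).hom.lTensor P)
    (hw (ν k))
  rw [map_sub, lTensor_transition_transition, ← lTensor_d_transition] at h2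
  have h3 := Submodule.smul_mono_left (Ideal.pow_le_pow_right ((hkμ k).trans (hν k))) h2
  rw [map_sub, hdU] at h1
  have h4 := neg_mem (add_mem h3 h1)
  convert h4 using 1
  simp only [d, T, LinearMap.lTensor]
  abel

end Complete

/-! ### Vanishing of Tor for bounded torsion modules -/

section BoundedTorsion

variable {A : Type u} [CommRing A] {p : ℕ} {a : Fin p → A}

theorem IsWeaklyProregularSeq.isKoszulProzero_self (ha : IsWeaklyProregularSeq a) :
    IsKoszulProzero a A :=
  fun _ hn _ hj => ha.homologyNull hn hj

theorem IsWeaklyProregularSeq.isKoszulProzero (ha : IsWeaklyProregularSeq a) (P : Type u)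
    [AddCommGroup P] [Module A P] [IsAdicComplete (Ideal.span (Set.range a)) P]
    (hP : ∀ k : ℕ, Module.Flat (A ⧸ Ideal.span (Set.range a) ^ (k + 1))
      ((A ⧸ Ideal.span (Set.range a) ^ (k + 1)) ⊗[A] P)) :
    IsKoszulProzero a P := by
  refine isKoszulProzero_of_approx (Ideal.span (Set.range a)) fun n hn j₀ hj₀ => ?_
  obtain ⟨n, rfl⟩ : ∃ n', n = n' + 1 := ⟨n - 1, by omega⟩
  obtain ⟨j₁, h, hnull⟩ := ha.homologyNull hn hj₀
  refine ⟨j₁, h, fun k => ?_⟩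
  obtain ⟨m, hm, hkm⟩ := exists_homologyNull_rTensor_quotientPowFactor ha.isKoszulProzero_self
    (fun l => koszulComplex_isNullHomotopicSMul (fun i => a i ^ j₁) l) hnull P hP k
  refine ⟨m + 1, by omega, fun z hz => ?_⟩
  obtain ⟨w, hw⟩ := hkm.exists_sub_mem z hz
  exact ⟨w, Submodule.smul_mono_left (Ideal.pow_le_pow_right (Nat.le_succ k)) hw⟩

instance projectiveResolution_flat {N : ModuleCat.{u} A} (G : ProjectiveResolution N) (i : ℕ) :
    Module.Flat A (G.complex.X i) :=
  have : Module.Projective A (G.complex.X i) :=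
    (IsProjective.iff_projective _).mpr (G.projective i)
  inferInstance

theorem projectiveResolution_exact {N : ModuleCat.{u} A} (G : ProjectiveResolution N) (n : ℕ) :
    Function.Exact (G.complex.d (n + 2) (n + 1)).hom (G.complex.d (n + 1) n).hom := by
  rw [LinearMap.exact_iff, eq_comm]
  exact (G.exact_succ n).moduleCat_range_eq_ker

theorem homologyNull_id_of_flat {N : ModuleCat.{u} A} (G : ProjectiveResolution N) (Q : Type u)
    [AddCommGroup Q] [Module A Q] [Module.Flat A Q] (n : ℕ) :
    HomologyNull (𝟙 G.complex) (LinearMap.id : Q →ₗ[A] Q) (n + 1) := by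
  rw [homologyNull_id_iff]
  intro z hz
  obtain ⟨w, rfl⟩ := (Module.Flat.lTensor_exact Q (projectiveResolution_exact G n) z).mp hz
  exact ⟨w, by rw [LinearMap.rTensor_id]; rfl⟩

theorem IsWeaklyProregularSeq.homologyNull_projectiveResolution (ha : IsWeaklyProregularSeq a)
    (P : Type u) [AddCommGroup P] [Module A P] [IsAdicComplete (Ideal.span (Set.range a)) P]
    (hP : ∀ k : ℕ, Module.Flat (A ⧸ Ideal.span (Set.range a) ^ (k + 1))
      ((A ⧸ Ideal.span (Set.range a) ^ (k + 1)) ⊗[A] P))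
    {N : ModuleCat.{u} A} {q : ℕ} (hN : ∀ r ∈ Ideal.span (Set.range a) ^ q, ∀ x : N, r • x = 0)
    (G : ProjectiveResolution N) (n : ℕ) :
    HomologyNull (𝟙 G.complex) (LinearMap.id : P →ₗ[A] P) (n + 1) := by
  have hG (l : Fin p) : IsNullHomotopicSMul G.complex (a l ^ q) :=
    projectiveResolution_isNullHomotopicSMul G
      (hN _ (Ideal.pow_mem_pow (Ideal.subset_span (Set.mem_range_self l)) q))
  -- First `k` is chosen so that `𝔞^k P → 𝔞^0 P = P` is null, then `m` so that `P_m → P_k` is null;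
  -- the identity of `P` is then null in the middle.
  obtain ⟨k, hk, hnull⟩ := exists_homologyNull_pow_smul_top (ha.isKoszulProzero P hP) hG (n + 1) 0
  obtain ⟨m, hm, hkm⟩ := exists_homologyNull_rTensor_quotientPowFactor ha.isKoszulProzero_self hG
    (homologyNull_id_of_flat G A n) P hP k
  exact HomologyNull.of_exact_middle (fY := LinearMap.id) (gY := LinearMap.id)
    (ι' := (Ideal.span (Set.range a) ^ (k + 1) • (⊤ : Submodule A P)).subtype)
    (ι'' := (Ideal.span (Set.range a) ^ 0 • (⊤ : Submodule A P)).subtype)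
    (π := TensorProduct.mk A (A ⧸ Ideal.span (Set.range a) ^ (m + 1)) P 1)
    (π' := TensorProduct.mk A (A ⧸ Ideal.span (Set.range a) ^ (k + 1)) P 1)
    (Submodule.subtype_injective _)
    (exact_subtype_smul_top_mk (Ideal.span (Set.range a) ^ (k + 1)) P)
    (surjective_mk_one (Ideal.span (Set.range a) ^ (k + 1)) P)
    (LinearMap.ext fun _ => rfl) (quotientPowFactor_rTensor_mk _ hm P) hkm
    (hnull.precomp_coeff (Submodule.inclusion
      (Submodule.smul_mono_left (Ideal.pow_le_pow_right (Nat.le_succ k)))))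

end BoundedTorsion

/-! ### Dimension shifting -/

section DimensionShift

variable {A : Type u} [CommRing A] {N : ModuleCat.{u} A} (G : ProjectiveResolution N)

/-- The augmentation of a projective resolution, as a linear map. -/
def projectiveResolutionAugmentation : G.complex.X 0 →ₗ[A] N :=
  (G.π.f 0).hom

theorem projectiveResolution_exact_augmentation :
    Function.Exact (G.complex.d 1 0).hom (projectiveResolutionAugmentation G) := by
  rw [LinearMap.exact_iff, eq_comm]
  exact G.exact₀.moduleCat_range_eq_ker

theorem projectiveResolutionAugmentation_surjective :
    Function.Surjective (projectiveResolutionAugmentation G) :=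
  (ModuleCat.epi_iff_surjective (G.π.f 0)).mp inferInstance

variable {P' Q P : Type u} [AddCommGroup P'] [Module A P'] [AddCommGroup Q] [Module A Q]
  [AddCommGroup P] [Module A P] {ι : P' →ₗ[A] Q} {π : Q →ₗ[A] P}

variable {G}

/-- A chase: if the connecting map out of `H_{n+1}(P ⊗ G)` has zero source, then cycles of `P'`
which bound in `Q` bound in `P'`. -/
theorem HomologyNull.exists_d_eq_of_map_eq_d (hι : Function.Injective ι)
    (hιπ : Function.Exact ι π) (hπ : Function.Surjective π) {n : ℕ}
    (h : HomologyNull (𝟙 G.complex) (LinearMap.id : P →ₗ[A] P) (n + 1))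
    (x : P' ⊗[A] G.complex.X n) (y : Q ⊗[A] G.complex.X (n + 1))
    (hxy : (G.complex.d (n + 1) n).hom.lTensor Q y = ι.rTensor _ x) :
    ∃ v, (G.complex.d (n + 1) n).hom.lTensor P' v = x := by
  obtain ⟨w, hw⟩ := homologyNull_id_iff.mp h (π.rTensor _ y) (by
    rw [Nat.add_sub_cancel, lTensor_d_rTensor, hxy, ← LinearMap.rTensor_comp_apply,
      hιπ.linearMap_comp_eq_zero]
    simp)
  obtain ⟨w, rfl⟩ := LinearMap.rTensor_surjective _ hπ w
  rw [LinearMap.rTensor_id, LinearMap.id_apply, lTensor_d_rTensor, eq_comm, ← sub_eq_zero,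
    ← map_sub] at hw
  obtain ⟨v, hv⟩ := (rTensor_exact _ hιπ hπ _).mp hw
  refine ⟨v, ?_⟩
  apply Module.Flat.rTensor_preserves_injective_linearMap (M := G.complex.X n) ι hι
  rw [← lTensor_d_rTensor, hv, map_sub, lTensor_d_d, sub_zero, hxy]

/-- Flatness of `Q` makes `Q ⊗ G` acyclic in positive degrees, so the connecting map `H_{n+2}(P ⊗ G)
→ H_{n+1}(P' ⊗ G)` is an isomorphism. -/
theorem homologyNull_id_succ_succ_iff [Module.Flat A Q] (hι : Function.Injective ι)
    (hιπ : Function.Exact ι π) (hπ : Function.Surjective π) (n : ℕ) :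
    HomologyNull (𝟙 G.complex) (LinearMap.id : P →ₗ[A] P) (n + 2) ↔
      HomologyNull (𝟙 G.complex) (LinearMap.id : P' →ₗ[A] P') (n + 1) := by
  constructor
  · intro h
    rw [homologyNull_id_iff]
    intro x hx
    obtain ⟨y, hy⟩ := homologyNull_id_iff.mp (homologyNull_id_of_flat G Q n) (ι.rTensor _ x) (by
      rw [lTensor_d_rTensor, hx, map_zero])
    rw [LinearMap.rTensor_id, LinearMap.id_apply] at hy
    obtain ⟨v, hv⟩ := h.exists_d_eq_of_map_eq_d hι hιπ hπ x y hy
    exact ⟨v, by rw [LinearMap.rTensor_id, LinearMap.id_apply]; exact hv⟩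
  · intro h
    exact HomologyNull.of_exact_right (fY := LinearMap.id) (gZ := LinearMap.id)
      (fZ := LinearMap.id) (ι' := ι) (π' := π) (π'' := π) hι hιπ hπ hιπ.linearMap_comp_eq_zero rfl rfl rfl h
      (homologyNull_id_of_flat G Q (n + 1))

/-- The right-hand side mentions `N` but not its resolution, so it can be compared for submodules of
`N` without relating their resolutions. -/
theorem homologyNull_id_one_iff [Module.Flat A Q] (hι : Function.Injective ι)
    (hιπ : Function.Exact ι π) (hπ : Function.Surjective π) :
    HomologyNull (𝟙 G.complex) (LinearMap.id : P →ₗ[A] P) 1 ↔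
      Function.Injective (ι.rTensor N) := by
  let ε := projectiveResolutionAugmentation G
  have hε := projectiveResolution_exact_augmentation G
  have hε' := projectiveResolutionAugmentation_surjective G
  have hcomm (x : P' ⊗[A] G.complex.X 0) :
      ι.rTensor N (ε.lTensor P' x) = ε.lTensor Q (ι.rTensor _ x) := by
    rw [← LinearMap.comp_apply, ← LinearMap.comp_apply, LinearMap.rTensor_comp_lTensor,
      LinearMap.lTensor_comp_rTensor]
  constructor
  · intro h
    rw [injective_iff_map_eq_zero]
    intro x hx
    obtain ⟨x, rfl⟩ := LinearMap.lTensor_surjective P' hε' x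
    rw [hcomm] at hx
    obtain ⟨y, hy⟩ := (lTensor_exact Q hε hε' _).mp hx
    obtain ⟨v, rfl⟩ := h.exists_d_eq_of_map_eq_d hι hιπ hπ x y hy
    exact (lTensor_exact P' hε hε').apply_apply_eq_zero v
  · intro h
    rw [homologyNull_id_iff]
    intro z hz
    obtain ⟨y, rfl⟩ := LinearMap.rTensor_surjective _ hπ z
    rw [lTensor_d_rTensor] at hz
    obtain ⟨x, hx⟩ := (rTensor_exact _ hιπ hπ _).mp hz
    obtain ⟨v, rfl⟩ := (lTensor_exact P' hε hε' x).mp (by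
      apply h
      rw [map_zero]
      refine (hcomm x).trans ?_
      rw [hx]
      exact (lTensor_exact Q hε hε').apply_apply_eq_zero y)
    obtain ⟨u, hu⟩ := homologyNull_id_iff.mp (homologyNull_id_of_flat G Q 0) (y - ι.rTensor _ v) (by
      rw [map_sub, lTensor_d_rTensor]
      exact sub_eq_zero.mpr hx.symm)
    rw [LinearMap.rTensor_id, LinearMap.id_apply] at hu
    refine ⟨π.rTensor _ u, ?_⟩
    rw [lTensor_d_rTensor, hu, LinearMap.rTensor_id, LinearMap.id_apply, map_sub,
      ← LinearMap.rTensor_comp_apply, hιπ.linearMap_comp_eq_zero]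
    simp

theorem homologyNull_id_succ_succ_iff_ker [Module.Flat A Q] (hπ : Function.Surjective π) (n : ℕ) :
    HomologyNull (𝟙 G.complex) (LinearMap.id : P →ₗ[A] P) (n + 2) ↔
      HomologyNull (𝟙 G.complex) (LinearMap.id : LinearMap.ker π →ₗ[A] LinearMap.ker π) (n + 1) :=
  homologyNull_id_succ_succ_iff (Submodule.subtype_injective _)
    (LinearMap.exact_subtype_ker_map π) hπ n

theorem homologyNull_id_one_iff_ker [Module.Flat A Q] (hπ : Function.Surjective π) :
    HomologyNull (𝟙 G.complex) (LinearMap.id : P →ₗ[A] P) 1 ↔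
      Function.Injective ((LinearMap.ker π).subtype.rTensor N) :=
  homologyNull_id_one_iff (Submodule.subtype_injective _) (LinearMap.exact_subtype_ker_map π) hπ

end DimensionShift

/-! ### Torsion modules -/

section Torsion

variable {A : Type u} [CommRing A] {𝔞 : Ideal A}

theorem Ideal.IsTorsionModule.exists_lTensor_subtype_eq {N : Type u} [AddCommGroup N] [Module A N]
    (hN : 𝔞.IsTorsionModule N) {P : Type u} [AddCommGroup P] [Module A P] (x : P ⊗[A] N) :
    ∃ (q : ℕ) (y : P ⊗[A] Submodule.torsionBySet A N ((𝔞 ^ q : Ideal A) : Set A)),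
      (Submodule.torsionBySet A N ((𝔞 ^ q : Ideal A) : Set A)).subtype.lTensor P y = x := by
  have hmono {q q' : ℕ} (h : q ≤ q') :
      Submodule.torsionBySet A N ((𝔞 ^ q : Ideal A) : Set A) ≤
        Submodule.torsionBySet A N ((𝔞 ^ q' : Ideal A) : Set A) :=
    Submodule.torsionBySet_le_torsionBySet_of_subset (Ideal.pow_le_pow_right h)
  have hincl {q q' : ℕ} (h : q ≤ q')
      (y : P ⊗[A] Submodule.torsionBySet A N ((𝔞 ^ q : Ideal A) : Set A)) :
      (Submodule.subtype _).lTensor P ((Submodule.inclusion (hmono h)).lTensor P y) =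
        (Submodule.subtype _).lTensor P y := by
    rw [← LinearMap.lTensor_comp_apply, Submodule.subtype_comp_inclusion]
  induction x using TensorProduct.induction_on with
  | zero => exact ⟨0, 0, map_zero _⟩
  | add x y hx hy =>
    obtain ⟨q, x, rfl⟩ := hx
    obtain ⟨q', y, rfl⟩ := hy
    exact ⟨max q q', (Submodule.inclusion (hmono (le_max_left q q'))).lTensor P x +
      (Submodule.inclusion (hmono (le_max_right q q'))).lTensor P y, by
        rw [map_add, hincl (le_max_left q q'), hincl (le_max_right q q')]⟩
  | tmul x n =>
    obtain ⟨q, -, hq⟩ := hN n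
    exact ⟨q, x ⊗ₜ ⟨n, (Submodule.mem_torsionBySet_iff _ _).mpr fun r => hq r r.2⟩, rfl⟩

/-- An element of the kernel comes from some `P' ⊗ N[𝔞^q]`. Flatness of `Q` embeds `Q ⊗ N[𝔞^q]` in
`Q ⊗ N`, so it already dies at that level. -/
theorem Ideal.IsTorsionModule.rTensor_injective {N P' Q : Type u} [AddCommGroup N] [Module A N]
    (hN : 𝔞.IsTorsionModule N) [AddCommGroup P'] [Module A P'] [AddCommGroup Q] [Module A Q]
    [Module.Flat A Q] {ι : P' →ₗ[A] Q}
    (H : ∀ q, Function.Injective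
      (ι.rTensor (Submodule.torsionBySet A N ((𝔞 ^ q : Ideal A) : Set A)))) :
    Function.Injective (ι.rTensor N) := by
  rw [injective_iff_map_eq_zero]
  intro x hx
  obtain ⟨q, y, rfl⟩ := hN.exists_lTensor_subtype_eq x
  have hy : y = 0 := by
    apply H q
    apply Module.Flat.lTensor_preserves_injective_linearMap (M := Q)
      (Submodule.torsionBySet A N ((𝔞 ^ q : Ideal A) : Set A)).subtype
      (Submodule.subtype_injective _)
    rw [map_zero, map_zero, ← hx, ← LinearMap.comp_apply, ← LinearMap.comp_apply,
      LinearMap.lTensor_comp_rTensor, LinearMap.rTensor_comp_lTensor]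
  rw [hy, map_zero]

theorem Ideal.IsTorsionModule.homologyNull_one {N : ModuleCat.{u} A} (hN : 𝔞.IsTorsionModule N)
    (G : ProjectiveResolution N) {P Q : Type u} [AddCommGroup P] [Module A P] [AddCommGroup Q]
    [Module A Q] [Module.Flat A Q] {π : Q →ₗ[A] P} (hπ : Function.Surjective π)
    (H : ∀ (q : ℕ) (N' : ModuleCat.{u} A), (∀ r ∈ 𝔞 ^ q, ∀ x : N', r • x = 0) →
      ∀ G' : ProjectiveResolution N',
        HomologyNull (𝟙 G'.complex) (LinearMap.id : P →ₗ[A] P) 1) :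
    HomologyNull (𝟙 G.complex) (LinearMap.id : P →ₗ[A] P) 1 := by
  refine (homologyNull_id_one_iff_ker hπ).mpr ?_
  refine Ideal.IsTorsionModule.rTensor_injective hN fun q => ?_
  let T := Submodule.torsionBySet A N ((𝔞 ^ q : Ideal A) : Set A)
  let G' := projectiveResolution (ModuleCat.of A T)
  have hT (r : A) (hr : r ∈ 𝔞 ^ q) (x : T) : r • x = 0 :=
    Subtype.ext ((Submodule.mem_torsionBySet_iff _ _).mp x.2 ⟨r, hr⟩)
  exact (homologyNull_id_one_iff_ker (G := G') hπ).mp (H q (ModuleCat.of A T) hT G')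

/-- Replacing `P` by the kernel of a free cover lowers the degree to 1. The hypothesis shifts along
with it, which is why the induction varies `P`. -/
theorem Ideal.IsTorsionModule.homologyNull {N : ModuleCat.{u} A} (hN : 𝔞.IsTorsionModule N)
    (G : ProjectiveResolution N) (P : Type u) [AddCommGroup P] [Module A P] (n : ℕ)
    (H : ∀ (q : ℕ) (N' : ModuleCat.{u} A), (∀ r ∈ 𝔞 ^ q, ∀ x : N', r • x = 0) →
      ∀ G' : ProjectiveResolution N',
        HomologyNull (𝟙 G'.complex) (LinearMap.id : P →ₗ[A] P) (n + 1)) :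
    HomologyNull (𝟙 G.complex) (LinearMap.id : P →ₗ[A] P) (n + 1) := by
  have hπ : Function.Surjective (Finsupp.linearCombination A (id : P → P)) :=
    Finsupp.linearCombination_id_surjective A P
  induction n generalizing P with
  | zero =>
    exact Ideal.IsTorsionModule.homologyNull_one hN G hπ H
  | succ n ih =>
    refine (homologyNull_id_succ_succ_iff_ker hπ n).mpr ?_
    exact ih _ (fun q N' hN' G' => (homologyNull_id_succ_succ_iff_ker hπ n).mp (H q N' hN' G'))
      (Finsupp.linearCombination_id_surjective A _)

end Torsion

/-! ### Tor -/

section TorVanishing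

variable {A : Type u} [CommRing A]

theorem isZero_tor_iff {N : ModuleCat.{u} A} (G : ProjectiveResolution N) (P : Type u)
    [AddCommGroup P] [Module A P] (n : ℕ) :
    Limits.IsZero (((Tor (ModuleCat.{u} A) (n + 1)).obj (ModuleCat.of A P)).obj N) ↔
      HomologyNull (𝟙 G.complex) (LinearMap.id : P →ₗ[A] P) (n + 1) := by
  let F := (MonoidalCategory.tensoringLeft (ModuleCat.{u} A)).obj (ModuleCat.of A P)
  have h1 := (G.isoLeftDerivedObj F (n + 1)).isZero_iff
  refine h1.trans ?_
  refine (HomologicalComplex.exactAt_iff_isZero_homology _ _).symm.trans ?_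
  rw [HomologicalComplex.exactAt_iff' _ (n + 2) (n + 1) n (by simp) (by simp),
    ShortComplex.moduleCat_exact_iff, homologyNull_id_iff]
  refine forall_congr' fun z => forall_congr' fun _ => exists_congr fun w => ?_
  rw [LinearMap.rTensor_id]
  exact Iff.rfl

/-- This extracts from `Tor_1(P, N'') = 0` what the long exact sequence would give, by presenting
`N` as the cokernel of `G_1 → N' × G_0`. -/
theorem lTensor_injective_of_homologyNull {N' N N'' P : Type u} [AddCommGroup N'] [Module A N']
    [AddCommGroup N] [Module A N] [AddCommGroup N''] [Module A N''] [AddCommGroup P] [Module A P]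
    {f : N' →ₗ[A] N} {g : N →ₗ[A] N''} (hf : Function.Injective f) (hfg : Function.Exact f g)
    (hg : Function.Surjective g) (G : ProjectiveResolution (ModuleCat.of A N''))
    (h : HomologyNull (𝟙 G.complex) (LinearMap.id : P →ₗ[A] P) 1) :
    Function.Injective (f.lTensor P) := by
  let ε : G.complex.X 0 →ₗ[A] N'' := projectiveResolutionAugmentation G
  have hε : Function.Exact (G.complex.d 1 0).hom ε := projectiveResolution_exact_augmentation G
  have : Module.Projective A (G.complex.X 0) :=
    (IsProjective.iff_projective _).mpr (G.projective 0)
  obtain ⟨α₀, hα₀⟩ := Module.projective_lifting_property g ε hg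
  let α₁ : G.complex.X 1 →ₗ[A] N' := (LinearEquiv.ofInjective f hf).symm.toLinearMap ∘ₗ
    (α₀ ∘ₗ (G.complex.d 1 0).hom).codRestrict (LinearMap.range f) (fun x => by
      refine (hfg _).mp ?_
      rw [← LinearMap.comp_apply, ← LinearMap.comp_assoc, hα₀, hε.linearMap_comp_eq_zero]
      rfl)
  have hα₁ (x : G.complex.X 1) : f (α₁ x) = α₀ ((G.complex.d 1 0).hom x) :=
    congrArg Subtype.val ((LinearEquiv.ofInjective f hf).apply_symm_apply _)
  have hα₁d : α₁ ∘ₗ (G.complex.d 2 1).hom = 0 := by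
    ext x
    apply hf
    have := LinearMap.congr_fun (congrArg ModuleCat.Hom.hom (G.complex.d_comp_d 2 1 0)) x
    rw [LinearMap.comp_apply, hα₁, LinearMap.zero_apply, map_zero]
    exact (congrArg α₀ this).trans (map_zero _)
  let s : G.complex.X 1 →ₗ[A] N' × G.complex.X 0 := (-α₁).prod (G.complex.d 1 0).hom
  let t : N' × G.complex.X 0 →ₗ[A] N := f.coprod α₀
  have hst : Function.Exact s t := by
    rintro ⟨n, x⟩
    constructor
    · intro hx
      have hx' : f n + α₀ x = 0 := hx
      obtain ⟨y, rfl⟩ := (hε x).mp (by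
        have := congrArg g hx'
        rwa [map_add, hfg.apply_apply_eq_zero, zero_add, map_zero, ← LinearMap.comp_apply,
          hα₀] at this)
      refine ⟨y, Prod.ext (hf ?_) rfl⟩
      change f (-α₁ y) = f n
      rw [map_neg, hα₁, eq_neg_of_add_eq_zero_left hx']
    · rintro ⟨y, hy⟩
      have hy' : (-α₁ y, (G.complex.d 1 0).hom y) = (n, x) := hy
      obtain ⟨rfl, rfl⟩ := Prod.mk.inj hy'
      change f (-α₁ y) + α₀ ((G.complex.d 1 0).hom y) = 0
      rw [map_neg, hα₁, neg_add_cancel]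
  have ht : Function.Surjective t := by
    intro n
    obtain ⟨x, hx⟩ := projectiveResolutionAugmentation_surjective G (g n)
    obtain ⟨m, hm⟩ := (hfg (n - α₀ x)).mp (by
      rw [map_sub, ← LinearMap.comp_apply, hα₀]
      exact sub_eq_zero.mpr hx.symm)
    exact ⟨(m, x), show f m + α₀ x = n by rw [hm, sub_add_cancel]⟩
  rw [injective_iff_map_eq_zero]
  intro x hx
  -- If `x` dies in `P ⊗ N`, then `(x, 0)` comes from some `y`. Its second component says that `y`
  -- is a cycle, hence a boundary; its first says `x = -α₁ y`, which vanishes because `α₁` kills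
  -- boundaries.
  obtain ⟨y, hy⟩ := (lTensor_exact P hst ht ((LinearMap.inl A N' (G.complex.X 0)).lTensor P x)).mp
    (by rw [← LinearMap.lTensor_comp_apply, LinearMap.coprod_inl, hx])
  have hy₁ := congrArg ((LinearMap.fst A N' (G.complex.X 0)).lTensor P) hy
  have hy₂ := congrArg ((LinearMap.snd A N' (G.complex.X 0)).lTensor P) hy
  rw [← LinearMap.lTensor_comp_apply, ← LinearMap.lTensor_comp_apply] at hy₁ hy₂
  rw [LinearMap.fst_prod, LinearMap.fst_comp_inl, LinearMap.lTensor_id] at hy₁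
  rw [LinearMap.snd_prod, LinearMap.snd_comp_inl, LinearMap.lTensor_zero] at hy₂
  obtain ⟨w, hw⟩ := homologyNull_id_iff.mp h y hy₂
  rw [LinearMap.rTensor_id, LinearMap.id_apply] at hw
  rw [← LinearMap.id_apply (R := A) x, ← hy₁, ← hw, LinearMap.lTensor_neg, LinearMap.neg_apply,
    ← LinearMap.lTensor_comp_apply, hα₁d]
  simp

end TorVanishing

/-! ### The equivalences -/

section Main

variable {A : Type u} [CommRing A] {𝔞 : Ideal A} {P : Type u} [AddCommGroup P] [Module A P]

theorem Ideal.IsTorsionModule.quotient {N : Type u} [AddCommGroup N] [Module A N]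
    (hN : 𝔞.IsTorsionModule N) (S : Submodule A N) : 𝔞.IsTorsionModule (N ⧸ S) := fun x => by
  obtain ⟨x, rfl⟩ := S.mkQ_surjective x
  obtain ⟨i, hi, h⟩ := hN x
  exact ⟨i, hi, fun r hr => by rw [← map_smul, h r hr, map_zero]⟩

/-- Right exactness handles the corestriction of `g` to its range. The inclusion of the range in
`N''` stays injective because its cokernel is torsion, so `Tor_1` vanishes on it. -/
theorem Ideal.IsAdicallyFlat.isTensorExactOnTorsion (h : 𝔞.IsAdicallyFlat P) :
    𝔞.IsTensorExactOnTorsion P := by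
  intro N' N N'' _ _ _ _ _ _ _ _ hN'' f g hfg
  have hinj : Function.Injective ((LinearMap.range g).subtype.lTensor P) := by
    let G := projectiveResolution (ModuleCat.of A (N'' ⧸ LinearMap.range g))
    exact lTensor_injective_of_homologyNull (Submodule.subtype_injective _)
      (LinearMap.exact_subtype_mkQ _) (Submodule.mkQ_surjective _) G
      ((isZero_tor_iff G P 0).mp (h _ (hN''.quotient _) 1 one_pos))
  have hexact : Function.Exact f g.rangeRestrict := fun x => by
    rw [← hfg x]
    exact Subtype.ext_iff
  have := lTensor_exact P hexact g.surjective_rangeRestrict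
  intro x
  rw [← this x, ← hinj.eq_iff, map_zero, ← LinearMap.lTensor_comp_apply]
  exact Iff.rfl

theorem Ideal.IsTensorExactOnTorsion.lTensor_injective (h : 𝔞.IsTensorExactOnTorsion P)
    {N N' : Type u} [AddCommGroup N] [Module A N] [AddCommGroup N'] [Module A N']
    (hN : 𝔞.IsTorsionModule N) (hN' : 𝔞.IsTorsionModule N') {f : N →ₗ[A] N'}
    (hf : Function.Injective f) : Function.Injective (f.lTensor P) := by
  have h0 : 𝔞.IsTorsionModule PUnit.{u + 1} := fun x => ⟨1, le_rfl, fun r _ => rfl⟩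
  have hex : Function.Exact (0 : PUnit.{u + 1} →ₗ[A] N) f := fun x => by
    rw [map_eq_zero_iff f hf]
    exact ⟨fun hx => ⟨0, hx.symm⟩, fun ⟨y, hy⟩ => hy.symm⟩
  have := h _ _ _ h0 hN hN' _ _ hex
  rw [injective_iff_map_eq_zero]
  intro x hx
  obtain ⟨y, hy⟩ := (this x).mp hx
  rw [← hy, LinearMap.lTensor_zero, LinearMap.zero_apply]

/-- Flatness is tested on ideals `I` of `A_k`, which are `𝔞`-torsion over `A`, using `I ⊗_{A_k} (A_k
⊗ P) ≅ I ⊗_A P`. -/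
theorem Ideal.IsTensorExactOnTorsion.flat (h : 𝔞.IsTensorExactOnTorsion P) (k : ℕ) :
    Module.Flat (A ⧸ 𝔞 ^ (k + 1)) ((A ⧸ 𝔞 ^ (k + 1)) ⊗[A] P) := by
  let B := A ⧸ 𝔞 ^ (k + 1)
  have htors (X : Type u) [AddCommGroup X] [Module A X] [Module B X] [IsScalarTower A B X] :
      𝔞.IsTorsionModule X := fun x => ⟨k + 1, by omega, fun r hr => by
    rw [← algebraMap_smul B r x, show algebraMap A B r = 0 from
      Ideal.Quotient.eq_zero_iff_mem.mpr hr, zero_smul]⟩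
  rw [Module.Flat.iff_rTensor_injective']
  intro I
  have hinj : Function.Injective ((I.subtype.restrictScalars A).rTensor P) := by
    rw [← LinearMap.lTensor_inj_iff_rTensor_inj]
    exact h.lTensor_injective (htors I) (htors B) (Submodule.subtype_injective I)
  let e (X : Type u) [AddCommGroup X] [Module A X] [Module B X] [IsScalarTower A B X] :=
    AlgebraTensorModule.cancelBaseChange A B B X P
  have hcomm (x : I ⊗[B] (B ⊗[A] P)) : e B (I.subtype.rTensor _ x) =
      (I.subtype.restrictScalars A).rTensor P (e I x) := by
    induction x using TensorProduct.induction_on with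
    | zero => simp
    | add x y hx hy => simp only [map_add, hx, hy]
    | tmul x y =>
      induction y using TensorProduct.induction_on with
      | zero => simp
      | add y y' hy hy' => simp only [TensorProduct.tmul_add, map_add, hy, hy']
      | tmul b p => rfl
  intro x y hxy
  apply (e I).injective
  apply hinj
  rw [← hcomm, ← hcomm, hxy]

theorem Ideal.IsWeaklyProregular.isAdicallyFlat (h𝔞 : 𝔞.IsWeaklyProregular) [IsAdicComplete 𝔞 P]
    (hP : ∀ k : ℕ, Module.Flat (A ⧸ 𝔞 ^ (k + 1)) ((A ⧸ 𝔞 ^ (k + 1)) ⊗[A] P)) :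
    𝔞.IsAdicallyFlat P := by
  obtain ⟨p, -, a, rfl, ha⟩ := h𝔞
  intro N _ _ hN i hi
  obtain ⟨n, rfl⟩ : ∃ n, i = n + 1 := ⟨i - 1, by omega⟩
  let G := projectiveResolution (ModuleCat.of A N)
  rw [isZero_tor_iff G]
  exact Ideal.IsTorsionModule.homologyNull (N := ModuleCat.of A N) hN G P n
    fun q N' hN' G' => ha.homologyNull_projectiveResolution P hP hN' G' n

end Main

end

theorem theorem0p1 {A : Type u} [CommRing A] (𝔞 : Ideal A) (h𝔞 : 𝔞.IsWeaklyProregular)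
    (P : Type u) [AddCommGroup P] [Module A P] [IsAdicComplete 𝔞 P] :
    List.TFAE [
      𝔞.IsAdicallyFlat P,
      𝔞.IsTensorExactOnTorsion P,
      ∀ k : ℕ, Module.Flat (A ⧸ 𝔞 ^ (k + 1)) ((A ⧸ 𝔞 ^ (k + 1)) ⊗[A] P)] := by
  tfae_have 1 → 2 := fun h => h.isTensorExactOnTorsion
  tfae_have 2 → 3 := fun h => h.flat
  tfae_have 3 → 1 := h𝔞.isAdicallyFlat
  tfae_finish
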